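/- A 4-cycle algebra is the algebra $A(n)$ of all complex partitioned matrices $$\begin{bmatrix} a_{11}&0&a_{13}&a_{14}\\ 0&a_{22}&a_{23}&a_{24}\\ 0&0&a_{33}&0\\ 0&0&0&a_{44}\end{bmatrix}\in M_r(\mathbb C),\qquad a_{ij}\in M_{n_i,n_j}(\mathbb C),\quad r=n_1+n_2+n_3+n_4,\quad n_i\ge 1 .$$ It generates $M_r(\mathbb C)$ as a star algebra. Its digraph has the indices $1,\dots,r$ as vertices and an edge for each matrix unit $e_{vw}\in A(n)$. Let $\Delta(A(n))$ be the simplicial complex whose $t$-simplices are the $(t+1)$-element vertex sets that span complete subgraphs of the underlying undirected graph, and let $H_1(A(n))=H_1(\Delta(A(n));\mathbb Z)$ be its first integral simplicial homology group. Let $D_4$ be the digraph of $A(1,1,1,1)$; it has exactly four automorphisms. A star extendible embedding $\alpha:A(n)\to A(m)$ is an injective (not necessarily unital) algebra homomorphism which extends to a star homomorphism of the generated full matrix algebras. It is rigid if it is conjugate, by a unitary of $A(m)\cap A(m)^*$, to a direct sum of multiplicity one embeddings $e_{vw}\mapsto e_{f_s(v)f_s(w)}$, where the $f_s$ are injective maps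 of indices with disjoint ranges and each $f_s$ maps the $i$-th block of indices into the $\sigma_s(i)$-th block for some automorphism $\sigma_s$ of $D_4$ (the type of the summand). It is generic if it is rigid and, in such a decomposition, each of the four types occurs at least once. A rigid embedding $\alpha$ induces $H_1(\alpha)=\sum_s H_1(f_s):H_1(A(n))\to H_1(A(m))$. A generic system is a sequence $\mathcal A=(A_k,\alpha_k)$ of 4-cycle algebras and rigid embeddings $\alpha_k:A_k\to A_{k+1}$, infinitely many of which are generic. Its limit algebra is the algebraic direct limit $A=\varinjlim(A_k,\alpha_k)$, contained in the star algebra $C=\varinjlim C^*(A_k)$ that it generates, and its limit homology group is $H_1(\{A_k,\alpha_k\})=\varinjlim(H_1(A_k),H_1(\alpha_k))$. Limit algebras $A$ and $A'$, with generated star algebras $C$ and $C'$, are star extendibly isomorphic if there is a star algebra isomorphism $\theta:C\to C'$ with $\theta(A)=A'$. **Theorem 3.3.** Let $(A_k,\alpha_k)$ and $(A'_k,\alpha'_k)$ be generic systems of 4-cycle algebras whose limit algebras $A$ and $A'$ are star extendibly isomorphic. Then, whichever direct sum decompositions of the embeddings $\alpha_k$, $\alpha'_k$ are used to compute the induced maps,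 the limit homology groups $H_1(\{A_k,\alpha_k\})$ and $H_1(\{A'_k,\alpha'_k\})$ are isomorphic abelian groups. -/

import Mathlib

noncomputable section

namespace FourCycle

/-! ### Simplicial homology of the complex of a digraph -/

section Homology

variable {V W X : Type}

/-- The `q`-simplices of the simplicial complex of a digraph with edge relation `r`, as ordered
tuples of vertices (repetitions allowed) spanning a complete subgraph of the underlying undirected
graph. -/
def Simplex (r : V → V → Prop) (q : ℕ) : Type :=
  {t : Fin (q + 1) → V // ∀ a b, t a = t b ∨ r (t a) (t b) ∨ r (t b) (t a)}

/-- The face of a simplex obtained by deleting the `a`-th vertex. -/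
def Simplex.face {r : V → V → Prop} {q : ℕ} (t : Simplex r (q + 1)) (a : Fin (q + 2)) :
    Simplex r q :=
  ⟨fun b => t.1 (a.succAbove b), fun b c => t.2 (a.succAbove b) (a.succAbove c)⟩

/-- The group of integral (ordered) simplicial `q`-chains. -/
abbrev Chains (r : V → V → Prop) (q : ℕ) : Type := Simplex r q →₀ ℤ

/-- The simplicial boundary map `∂ t = ∑ₐ (-1)ᵃ (t with its a-th vertex deleted)`. -/
def boundary (r : V → V → Prop) (q : ℕ) : Chains r (q + 1) →ₗ[ℤ] Chains r q :=
  Finsupp.linearCombination ℤ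
    (fun t : Simplex r (q + 1) =>
      ∑ a : Fin (q + 2), Finsupp.single (t.face a) ((-1 : ℤ) ^ (a : ℕ)))

/-- The first integral simplicial homology group: 1-cycles modulo boundaries of 2-chains. -/
abbrev H1 (r : V → V → Prop) : Type :=
  LinearMap.ker (boundary r 0) ⧸
    (LinearMap.range (boundary r 1)).submoduleOf (LinearMap.ker (boundary r 0))

/-- The action of an edge preserving map of digraphs on simplices. -/
def Simplex.map {r : V → V → Prop} {s : W → W → Prop} (f : V → W)
    (hf : ∀ v w, r v w → s (f v) (f w)) {q : ℕ} (t : Simplex r q) : Simplex s q :=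
  ⟨fun a => f (t.1 a), fun a b => (t.2 a b).imp (congrArg f) (Or.imp (hf _ _) (hf _ _))⟩

/-- The chain map induced by an edge preserving map of digraphs. -/
def chainMap {r : V → V → Prop} {s : W → W → Prop} (f : V → W)
    (hf : ∀ v w, r v w → s (f v) (f w)) (q : ℕ) : Chains r q →ₗ[ℤ] Chains s q :=
  Finsupp.lmapDomain ℤ ℤ (Simplex.map f hf)

theorem boundary_chainMap {r : V → V → Prop} {s : W → W → Prop} (f : V → W)
    (hf : ∀ v w, r v w → s (f v) (f w)) (q : ℕ) (c : Chains r (q + 1)) :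
    boundary s q (chainMap f hf (q + 1) c) = chainMap f hf q (boundary r q c) := by
  have h : (boundary s q) ∘ₗ (chainMap f hf (q + 1)) = (chainMap f hf q) ∘ₗ (boundary r q) := by
    apply Finsupp.lhom_ext
    intro t z
    simp only [boundary, chainMap, LinearMap.comp_apply, Finsupp.lmapDomain_apply,
      Finsupp.mapDomain_single, Finsupp.linearCombination_single, map_smul]
    simp only [Finset.smul_sum, Finsupp.mapDomain_finsetSum,
      Finsupp.mapDomain_single]
    rfl
  exact LinearMap.congr_fun h c

/-- The homomorphism `H₁(f)` induced by an edge preserving map of digraphs. -/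
def H1map {r : V → V → Prop} {s : W → W → Prop} (f : V → W)
    (hf : ∀ v w, r v w → s (f v) (f w)) : H1 r →+ H1 s :=
  (Submodule.mapQ _ _
    ((chainMap f hf 1).restrict (p := LinearMap.ker (boundary r 0))
      (q := LinearMap.ker (boundary s 0)) (fun c hc => by
        rw [LinearMap.mem_ker] at hc ⊢
        rw [boundary_chainMap, hc, map_zero]))
    (by
      rintro ⟨c, hc⟩ ⟨d, hd⟩
      exact ⟨chainMap f hf 2 d, by
        rw [boundary_chainMap, hd]
        rfl⟩)).toAddMonoidHom

end Homology

/-! ### 4-cycle algebras -/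

/-- The edge relation of the 4-cycle digraph `D₄`, with vertices `1, 2, 3, 4` written
`0, 1, 2, 3`: the loops and the edges `(1,3), (1,4), (2,3), (2,4)`. -/
def D4 (i j : Fin 4) : Prop := i = j ∨ ((i = 0 ∨ i = 1) ∧ (j = 2 ∨ j = 3))

/-- The symmetries of the digraph `D₄`. -/
def IsSymmetry (σ : Equiv.Perm (Fin 4)) : Prop := ∀ i j, D4 i j ↔ D4 (σ i) (σ j)

/-- The index set of the rows (and columns) of a partitioned matrix with block sizes
`n 0, n 1, n 2, n 3`. -/
abbrev Idx (n : Fin 4 → ℕ) : Type := Σ i : Fin 4, Fin (n i)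

/-- The full matrix algebra `M_r`, `r = n 0 + n 1 + n 2 + n 3`. -/
abbrev Mat (n : Fin 4 → ℕ) : Type := Matrix (Idx n) (Idx n) ℂ

/-- The edge relation of the digraph of a 4-cycle algebra: `(v, w)` is an edge iff the matrix unit
`e_{vw}` lies in the algebra. -/
def edge (n : Fin 4 → ℕ) (v w : Idx n) : Prop := D4 v.1 w.1

/-- The 4-cycle algebra with block sizes `n`: the matrices in `M_r` all of whose blocks vanish,
except possibly the diagonal ones and those in positions `(1,3), (1,4), (2,3), (2,4)`. -/
def cycleAlgebra (n : Fin 4 → ℕ) : Subalgebra ℂ (Mat n) where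
  carrier := {a | ∀ v w, ¬ edge n v w → a v w = 0}
  mul_mem' := by
    intro a b ha hb v w h
    rw [Matrix.mul_apply]
    refine Finset.sum_eq_zero fun x _ => ?_
    by_cases h1 : edge n v x
    · by_cases h2 : edge n x w
      · exact absurd (by unfold edge D4 at *; grind) h
      · rw [hb x w h2, mul_zero]
    · rw [ha v x h1, zero_mul]
  add_mem' := by
    intro a b ha hb v w h
    rw [Matrix.add_apply, ha v w h, hb v w h, add_zero]
  algebraMap_mem' := by
    intro c v w h
    have hvw : v ≠ w := fun e => h (Or.inl (congrArg Sigma.fst e))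
    simp [Matrix.algebraMap_matrix_apply, hvw]

theorem single_mem_cycleAlgebra {n : Fin 4 → ℕ} {v w : Idx n} (c : ℂ) (h : edge n v w) :
    Matrix.single v w c ∈ cycleAlgebra n := by
  intro x y hxy
  rw [Matrix.single_apply, if_neg]
  rintro ⟨rfl, rfl⟩
  exact hxy h

/-- The star algebra generated by a 4-cycle algebra (with nonempty blocks) is the full matrix
algebra, so that star extensions of maps of 4-cycle algebras are maps of full matrix algebras. -/
theorem adjoin_cycleAlgebra (n : Fin 4 → ℕ) (hn : ∀ i, 0 < n i) :
    StarAlgebra.adjoin ℂ (cycleAlgebra n : Set (Mat n)) = ⊤ := by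
  have hsub : ∀ {v w : Idx n} (c : ℂ), edge n v w →
      Matrix.single v w c ∈ StarAlgebra.adjoin ℂ (cycleAlgebra n : Set (Mat n)) :=
    fun c h => StarAlgebra.subset_adjoin ℂ _ (single_mem_cycleAlgebra c h)
  have hstar : ∀ {v w : Idx n} (c : ℂ), edge n w v →
      Matrix.single v w c ∈ StarAlgebra.adjoin ℂ (cycleAlgebra n : Set (Mat n)) := by
    intro v w c h
    have h1 := star_mem (hsub (star c) h)
    rwa [Matrix.star_eq_conjTranspose, Matrix.conjTranspose_single, star_star] at h1
  have key : ∀ (v w : Idx n) (c : ℂ),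
      Matrix.single v w c ∈ StarAlgebra.adjoin ℂ (cycleAlgebra n : Set (Mat n)) := by
    intro v w c
    by_cases hvw : edge n v w
    · exact hsub c hvw
    by_cases hwv : edge n w v
    · exact hstar c hwv
    by_cases hv : v.1 = 0 ∨ v.1 = 1
    · have hw : w.1 = 0 ∨ w.1 = 1 := by
        unfold edge D4 at *
        obtain ⟨i, x⟩ := v
        obtain ⟨j, y⟩ := w
        dsimp only at *
        fin_cases i <;> fin_cases j <;> simp_all
      have h1 := mul_mem (hsub (v := v) (w := ⟨2, ⟨0, hn 2⟩⟩) c (Or.inr ⟨hv, Or.inl rfl⟩))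
        (hstar (v := ⟨2, ⟨0, hn 2⟩⟩) (w := w) 1 (Or.inr ⟨hw, Or.inl rfl⟩))
      simpa using h1
    · have hv' : v.1 = 2 ∨ v.1 = 3 := by
        obtain ⟨i, x⟩ := v
        fin_cases i <;> simp_all
      have hw : w.1 = 2 ∨ w.1 = 3 := by
        unfold edge D4 at *
        obtain ⟨i, x⟩ := v
        obtain ⟨j, y⟩ := w
        dsimp only at *
        fin_cases i <;> fin_cases j <;> simp_all
      have h1 := mul_mem (hstar (v := v) (w := ⟨0, ⟨0, hn 0⟩⟩) c (Or.inr ⟨Or.inl rfl, hv'⟩))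
        (hsub (v := ⟨0, ⟨0, hn 0⟩⟩) (w := w) 1 (Or.inr ⟨Or.inl rfl, hw⟩))
      simpa using h1
  rw [eq_top_iff]
  intro a _
  rw [Matrix.matrix_eq_sum_single a]
  exact sum_mem fun v _ => sum_mem fun w _ => key v w _

/-- A star extendible embedding of the 4-cycle algebra with block sizes `n` into the one with
block sizes `m`, given by its (unique) extension to the generated star algebras. It need not be
unital. -/
structure StarEmbedding (n m : Fin 4 → ℕ) where
  /-- the star extension -/
  toHom : Mat n →⋆ₙₐ[ℂ] Mat m
  injective : Function.Injective toHom
  map_mem : ∀ a ∈ cycleAlgebra n, toHom a ∈ cycleAlgebra m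

/-- The multiplicity one map `e_{vw} ↦ e_{f(v) f(w)}` of full matrix algebras determined by a map
of the index sets. -/
def multOne {n m : Fin 4 → ℕ} (f : Idx n → Idx m) (x : Mat n) : Mat m :=
  ∑ v, ∑ w, Matrix.single (f v) (f w) (x v w)

/-- A presentation of a star extendible embedding of 4-cycle algebras as an inner conjugate of a
direct sum of multiplicity one rigid embeddings. -/
structure RigidDecomposition {n m : Fin 4 → ℕ} (α : StarEmbedding n m) where
  /-- the number of summands -/
  mult : ℕ
  /-- the type of each summand, a symmetry of `D₄` -/
  type : Fin mult → Equiv.Perm (Fin 4)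
  type_isSymmetry : ∀ s, IsSymmetry (type s)
  /-- the map of matrix indices which determines a summand -/
  emb : Fin mult → Idx n → Idx m
  /-- a summand permutes the blocks according to its type -/
  emb_block : ∀ s v, (emb s v).1 = type s v.1
  /-- the summands are multiplicity one embeddings with orthogonal ranges -/
  emb_injective : Function.Injective (fun p : Fin mult × Idx n => emb p.1 p.2)
  /-- the conjugating unitary -/
  u : Mat m
  u_unitary : u ∈ unitary (Mat m)
  /-- the conjugation is inner: `u` and its adjoint lie in the 4-cycle algebra -/
  u_mem : u ∈ cycleAlgebra m
  star_u_mem : star u ∈ cycleAlgebra m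
  map_eq : ∀ x, α.toHom x = u * (∑ s, multOne (emb s) x) * star u

/-- Rigid embeddings of 4-cycle algebras. -/
def IsRigid {n m : Fin 4 → ℕ} (α : StarEmbedding n m) : Prop := Nonempty (RigidDecomposition α)

/-- Generic embeddings of 4-cycle algebras: rigid, with at least one summand of each of the four
types. -/
def IsGeneric {n m : Fin 4 → ℕ} (α : StarEmbedding n m) : Prop :=
  ∃ D : RigidDecomposition α, ∀ σ, IsSymmetry σ → ∃ s, D.type s = σ

theorem RigidDecomposition.emb_edge {n m : Fin 4 → ℕ} {α : StarEmbedding n m}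
    (D : RigidDecomposition α) (s : Fin D.mult) (v w : Idx n) (h : edge n v w) :
    edge m (D.emb s v) (D.emb s w) := by
  unfold edge at *
  rw [D.emb_block, D.emb_block]
  exact (D.type_isSymmetry s _ _).1 h

/-- The induced homomorphism `H₁(α)`, computed as the sum of the simplicially induced maps of the
multiplicity one summands of `α`. -/
def RigidDecomposition.H1map {n m : Fin 4 → ℕ} {α : StarEmbedding n m}
    (D : RigidDecomposition α) : H1 (edge n) →+ H1 (edge m) :=
  ∑ s, FourCycle.H1map (D.emb s) (D.emb_edge s)

/-! ### Direct systems of 4-cycle algebras -/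

/-- A direct system `A₀ → A₁ → A₂ → ⋯` of 4-cycle algebras and star extendible embeddings. -/
structure System where
  /-- the block sizes of the algebras -/
  dim : ℕ → Fin 4 → ℕ
  dim_pos : ∀ k i, 0 < dim k i
  /-- the connecting embeddings -/
  map : ∀ k, StarEmbedding (dim k) (dim (k + 1))

namespace System

/-- A generic system: the embeddings are rigid, and infinitely many of them are generic. -/
def IsGeneric (A : System) : Prop :=
  (∀ k, IsRigid (A.map k)) ∧ ∀ N, ∃ k, N ≤ k ∧ FourCycle.IsGeneric (A.map k)

/-- The composed star homomorphisms `M(A_i) → M(A_j)`, `i ≤ j`. -/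
def trans (A : System) (i j : ℕ) (h : i ≤ j) : Mat (A.dim i) →⋆ₙₐ[ℂ] Mat (A.dim j) :=
  Nat.leRec (motive := fun j _ => Mat (A.dim i) →⋆ₙₐ[ℂ] Mat (A.dim j))
    (NonUnitalStarAlgHom.id ℂ _) (fun k _ g => (A.map k).toHom.comp g) h

theorem trans_self (A : System) (i : ℕ) : A.trans i i le_rfl = NonUnitalStarAlgHom.id ℂ _ :=
  Nat.leRec_self _ _

theorem trans_succ (A : System) (i j : ℕ) (h : i ≤ j) :
    A.trans i (j + 1) (h.trans (Nat.le_succ j)) = (A.map j).toHom.comp (A.trans i j h) :=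
  Nat.leRec_succ _ _ h

instance (A : System) : DirectedSystem (fun k => Mat (A.dim k)) (A.trans · · ·) where
  map_self i x := by rw [trans_self]; rfl
  map_map i j k hij hjk x := by
    induction hjk with
    | refl => rw [trans_self]; rfl
    | step h ih =>
      rw [trans_succ _ _ _ h, trans_succ _ _ _ (hij.trans h)]
      exact congrArg _ ih

theorem trans_mem (A : System) (i j : ℕ) (h : i ≤ j) (a : Mat (A.dim i))
    (ha : a ∈ cycleAlgebra (A.dim i)) : A.trans i j h a ∈ cycleAlgebra (A.dim j) := by
  induction h with
  | refl => rw [trans_self]; exact ha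
  | step h ih => rw [trans_succ _ _ _ h]; exact (A.map _).map_mem _ ih

/-- The star algebra generated by the limit algebra: the algebraic direct limit of the star
algebras generated by the `A_k`, that is, of the full matrix algebras. -/
abbrev StarLimit (A : System) : Type := DirectLimit (fun k => Mat (A.dim k)) A.trans

/-- The algebraic direct limit of the 4-cycle algebras `A_k`, realised in the star algebra which it
generates as the union of the images of the `A_k`. -/
def limit (A : System) : NonUnitalSubalgebra ℂ A.StarLimit where
  carrier := {x | ∃ k, ∃ a ∈ cycleAlgebra (A.dim k), x = ⟦⟨k, a⟩⟧}
  add_mem' := by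
    rintro _ _ ⟨i, a, ha, rfl⟩ ⟨j, b, hb, rfl⟩
    refine ⟨max i j, A.trans i _ (le_max_left i j) a + A.trans j _ (le_max_right i j) b,
      add_mem (A.trans_mem _ _ _ _ ha) (A.trans_mem _ _ _ _ hb), ?_⟩
    rw [← DirectLimit.add_def, DirectLimit.mk_apply, DirectLimit.mk_apply]
  zero_mem' := ⟨0, 0, zero_mem _, DirectLimit.zero_def 0⟩
  mul_mem' := by
    rintro _ _ ⟨i, a, ha, rfl⟩ ⟨j, b, hb, rfl⟩
    refine ⟨max i j, A.trans i _ (le_max_left i j) a * A.trans j _ (le_max_right i j) b,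
      mul_mem (A.trans_mem _ _ _ _ ha) (A.trans_mem _ _ _ _ hb), ?_⟩
    rw [← DirectLimit.mul_def, DirectLimit.mk_apply, DirectLimit.mk_apply]
  smul_mem' := by
    rintro c _ ⟨i, a, ha, rfl⟩
    exact ⟨i, c • a, Subalgebra.smul_mem _ ha c, by rw [DirectLimit.smul_def]⟩

/-- Star extendible isomorphism of limit algebras: an isomorphism of the limit algebras which is
the restriction of a star isomorphism of the star algebras they generate. -/
def StarExtendiblyIsomorphic (A B : System) : Prop :=
  ∃ θ : A.StarLimit ≃⋆ₐ[ℂ] B.StarLimit, ∀ x, θ x ∈ B.limit ↔ x ∈ A.limit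

/-- A choice of rigid decomposition for each of the embeddings of a system. -/
abbrev Decomposition (A : System) : Type := ∀ k, RigidDecomposition (A.map k)

variable {A : System}

/-- The composed homomorphisms `H₁(A_i) → H₁(A_j)`, `i ≤ j`. -/
def Decomposition.trans (D : A.Decomposition) (i j : ℕ) (h : i ≤ j) :
    H1 (edge (A.dim i)) →+ H1 (edge (A.dim j)) :=
  Nat.leRec (motive := fun j _ => H1 (edge (A.dim i)) →+ H1 (edge (A.dim j)))
    (AddMonoidHom.id _) (fun k _ g => (D k).H1map.comp g) h

theorem Decomposition.trans_self (D : A.Decomposition) (i : ℕ) :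
    D.trans i i le_rfl = AddMonoidHom.id _ :=
  Nat.leRec_self _ _

theorem Decomposition.trans_succ (D : A.Decomposition) (i j : ℕ) (h : i ≤ j) :
    D.trans i (j + 1) (h.trans (Nat.le_succ j)) = (D j).H1map.comp (D.trans i j h) :=
  Nat.leRec_succ _ _ h

instance (D : A.Decomposition) :
    DirectedSystem (fun k => H1 (edge (A.dim k))) (Decomposition.trans D · · ·) where
  map_self i x := by rw [Decomposition.trans_self]; rfl
  map_map i j k hij hjk x := by
    induction hjk with
    | refl => rw [Decomposition.trans_self]; rfl
    | step h ih =>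
      rw [Decomposition.trans_succ _ _ _ h, Decomposition.trans_succ _ _ _ (hij.trans h)]
      exact congrArg _ ih

/-- The limit homology group `H₁({A_k, α_k}) = lim (H₁(A_k), H₁(α_k))`, with the maps `H₁(α_k)`
computed from the given decompositions. -/
abbrev limitH1 (A : System) (D : A.Decomposition) : Type :=
  DirectLimit (fun k => H1 (edge (A.dim k))) (Decomposition.trans D)

end System

end FourCycle

end

set_option linter.unusedSectionVars false

noncomputable section

namespace FourCycle

open Matrix

open scoped Kronecker

/-! ### Kraus families -/

section Kraus

variable {ι ι' ι'' : Type} [Fintype ι] [DecidableEq ι] [Fintype ι'] [DecidableEq ι']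
  [Fintype ι''] [DecidableEq ι''] {κ κ' : Type} [Fintype κ] [DecidableEq κ]
  [Fintype κ'] [DecidableEq κ']

/-! The first homology of every 4-cycle algebra is infinite cyclic, generated by a loop through the
four blocks, and a symmetry of `D4` acts on it by a sign. So `H₁` of a rigid embedding is
multiplication by an integer, the sum of the signs of its summands. The point is to recover this
integer from the star homomorphism alone, in a way that also makes sense for the maps between the
two systems, which are not known to be rigid.

A star homomorphism has the form `x ↦ ∑ V k * x * (V k)ᴴ`, with isometries `V k` unique up to a
unitary of the multiplicity space (`IsKraus.exists_unitary`). The block symmetry `diag(1, -1, 1,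
-1)` acts on the ranges of the `V k` through four involutions `S i` of that space, its symbol. For a
rigid embedding the `S i` are diagonal with entries `jsign (σ i)`, so `S 1 = -S 0`, `S 3 = -S 2`,
and the trace of `S 0 * S 2` is the homology multiplier. This trace, the winding number, is
independent of the family and multiplicative (`HasWinding.unique`, `HasWinding.comp`).

An isomorphism of the limits lifts to maps `φ` and `ψ` between finite stages whose composite `ψ ∘ φ`
is a connecting map. The key step, `exists_hasWinding_of_comp`, shows that `φ` inherits the sign
relations and has an integral winding number. It rests on two facts about Kronecker products of
involutions, `eq_neg_of_kronecker_eq` and `exists_int_trace_eq_of_kronecker`. Multiplication by the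
winding numbers of the lifts then gives mutually inverse maps of the limit groups. -/

/-- A family of isometries with orthogonal ranges which implements a star homomorphism of matrix
algebras. -/
structure IsKraus (α : Matrix ι ι ℂ →⋆ₙₐ[ℂ] Matrix ι' ι' ℂ) (V : κ → Matrix ι' ι ℂ) : Prop where
  orth : ∀ k l, (V k)ᴴ * V l = if k = l then 1 else 0
  form : ∀ x, α x = ∑ k, V k * x * (V k)ᴴ

namespace IsKraus

variable {α : Matrix ι ι ℂ →⋆ₙₐ[ℂ] Matrix ι' ι' ℂ} {V : κ → Matrix ι' ι ℂ} {W : κ' → Matrix ι' ι ℂ}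

theorem map_mul (h : IsKraus α V) (x : Matrix ι ι ℂ) (l : κ) : α x * V l = V l * x := by
  simp only [h.form, Matrix.sum_mul, Matrix.mul_assoc, h.orth]
  exact (Finset.sum_eq_single l (by intro b _ hb; simp [hb]) (by simp)).trans (by simp)

theorem conjTranspose_mul_map (h : IsKraus α V) (x : Matrix ι ι ℂ) (l : κ) :
    (V l)ᴴ * α x = x * (V l)ᴴ := by
  simp only [h.form, Matrix.mul_sum, ← Matrix.mul_assoc, h.orth]
  exact (Finset.sum_eq_single l (by intro b _ hb; simp [hb.symm]) (by simp)).trans (by simp)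

theorem map_one (h : IsKraus α V) : α 1 = ∑ k, V k * (V k)ᴴ := by
  simp [h.form]

theorem sum_mul_cancel {ν : Type} (h : IsKraus α V) (M : κ → Matrix ι ν ℂ) (k : κ) :
    (V k)ᴴ * ∑ l, V l * M l = M k := by
  simp only [Matrix.mul_sum, ← Matrix.mul_assoc, h.orth]
  exact (Finset.sum_eq_single k (by intro b _ hb; simp [hb.symm]) (by simp)).trans (by simp)

protected theorem id :
    IsKraus (NonUnitalStarAlgHom.id ℂ (Matrix ι ι ℂ)) (fun _ : Unit => (1 : Matrix ι ι ℂ)) where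
  orth k l := by simp
  form x := by simp

theorem comp {β : Matrix ι' ι' ℂ →⋆ₙₐ[ℂ] Matrix ι'' ι'' ℂ} {W : κ' → Matrix ι'' ι' ℂ}
    (hβ : IsKraus β W) (hα : IsKraus α V) :
    IsKraus (β.comp α) (fun p : κ × κ' => W p.2 * V p.1) where
  orth := by
    rintro ⟨a, b⟩ ⟨a', b'⟩
    have : (W b * V a)ᴴ * (W b' * V a') = (V a)ᴴ * ((W b)ᴴ * W b') * V a' := by
      simp [Matrix.mul_assoc]
    rw [this, hβ.orth]
    by_cases hb : b = b'
    · simp [hb, hα.orth]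
    · simp [hb]
  form x := by
    rw [NonUnitalStarAlgHom.comp_apply, hβ.form, hα.form, Fintype.sum_prod_type_right]
    simp [Matrix.mul_sum, Matrix.sum_mul, Matrix.mul_assoc]

/-- Both families intertwine `α`, so this product commutes with every matrix and is therefore
scalar. -/
theorem scalar_conjTranspose_mul (hV : IsKraus α V) (hW : IsKraus α W) (i₀ : ι) (k : κ) (l : κ') :
    (V k)ᴴ * W l = ((V k)ᴴ * W l) i₀ i₀ • (1 : Matrix ι ι ℂ) := by
  have hcomm : ∀ x, Commute x ((V k)ᴴ * W l) := fun x => by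
    rw [Commute, SemiconjBy, ← Matrix.mul_assoc, ← hV.conjTranspose_mul_map, Matrix.mul_assoc,
      hW.map_mul, Matrix.mul_assoc]
  obtain ⟨c, hc⟩ := Matrix.mem_range_scalar_of_commute_single (M := (V k)ᴴ * W l)
    (fun i j _ => hcomm _)
  rw [← hc]
  simp [Matrix.smul_one_eq_diagonal]

/-- `α 1` is the projection onto the sum of the ranges of the `V k`, and `M` leaves that sum
invariant. -/
theorem expand (hV : IsKraus α V) {M : Matrix ι' ι' ℂ} (hM : Commute M (α 1)) (l : κ) :
    M * V l = ∑ k, V k * ((V k)ᴴ * M * V l) := by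
  conv_lhs => rw [← Matrix.mul_one (V l), ← hV.map_mul, ← Matrix.mul_assoc, hM.eq, hV.map_one]
  simp [Matrix.sum_mul, Matrix.mul_assoc]

/-- The scalars `(V k)ᴴ * W l` form the transition matrix between two orthonormal bases of the same
space of intertwiners. -/
theorem exists_unitary [Nonempty ι] (hV : IsKraus α V) (hW : IsKraus α W) :
    ∃ u : Matrix κ κ' ℂ, uᴴ * u = 1 ∧ u * uᴴ = 1 ∧ (∀ l, W l = ∑ k, u k l • V k) ∧
      ∀ k, V k = ∑ l, star (u k l) • W l := by
  have i₀ : ι := Classical.arbitrary ι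
  let u : Matrix κ κ' ℂ := of fun k l => ((V k)ᴴ * W l) i₀ i₀
  have hu : ∀ k l, (V k)ᴴ * W l = u k l • (1 : Matrix ι ι ℂ) :=
    fun k l => scalar_conjTranspose_mul hV hW i₀ k l
  have hu' : ∀ k l, (W l)ᴴ * V k = star (u k l) • (1 : Matrix ι ι ℂ) := fun k l => by
    have := congrArg conjTranspose (hu k l)
    simpa using this
  have h1 : ∀ l, W l = ∑ k, u k l • V k := fun l => by
    conv_lhs => rw [← Matrix.mul_one (W l), ← hW.map_mul, hV.map_one]
    simp [Matrix.sum_mul, Matrix.mul_assoc, hu]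
  have h2 : ∀ k, V k = ∑ l, star (u k l) • W l := fun k => by
    conv_lhs => rw [← Matrix.mul_one (V k), ← hV.map_mul, hW.map_one]
    simp [Matrix.sum_mul, Matrix.mul_assoc, hu']
  refine ⟨u, ?_, ?_, h1, h2⟩
  · ext l l'
    have h := hW.orth l l'
    rw [h1 l', Matrix.mul_sum] at h
    have h := congrFun (congrFun h i₀) i₀
    simp only [Matrix.mul_smul, hu', Matrix.sum_apply, Matrix.smul_apply, Matrix.one_apply_eq] at h
    rw [Matrix.mul_apply, Matrix.one_apply]
    simp only [conjTranspose_apply]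
    split_ifs at h ⊢ <;> simpa [mul_comm] using h
  · ext k k'
    have h := hV.orth k k'
    rw [h2 k', Matrix.mul_sum] at h
    have h := congrFun (congrFun h i₀) i₀
    simp only [Matrix.mul_smul, hu, Matrix.sum_apply, Matrix.smul_apply, Matrix.one_apply_eq] at h
    rw [Matrix.mul_apply, Matrix.one_apply]
    simp only [conjTranspose_apply]
    split_ifs at h ⊢ <;> simpa [mul_comm] using h

end IsKraus

/-! ### Existence of implementing families. -/

/-- A self-adjoint idempotent matrix is the range projection of an isometry. -/
theorem exists_isometry_of_projection {P : Matrix ι ι ℂ} (hP : P.IsHermitian) (hPP : P * P = P) :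
    ∃ (κ : Type) (_ : Fintype κ) (_ : DecidableEq κ) (W : Matrix ι κ ℂ),
      Wᴴ * W = 1 ∧ W * Wᴴ = P := by
  classical
  have hu := (hP.eigenvectorUnitary).2
  set U : Matrix ι ι ℂ := (hP.eigenvectorUnitary : Matrix ι ι ℂ) with hU
  have h1 : Uᴴ * U = 1 := (Unitary.mem_iff.1 hu).1
  have h2 : U * Uᴴ = 1 := (Unitary.mem_iff.1 hu).2
  set D : Matrix ι ι ℂ := diagonal (RCLike.ofReal ∘ hP.eigenvalues) with hD
  have hspec : P = U * D * Uᴴ := by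
    have := hP.spectral_theorem
    rwa [Unitary.conjStarAlgAut_apply] at this
  have hDD : D * D = D := by
    have : D = Uᴴ * P * U := by
      rw [hspec]
      simp only [Matrix.mul_assoc, h1, Matrix.mul_one]
      rw [← Matrix.mul_assoc, h1, Matrix.one_mul]
    rw [this]
    calc Uᴴ * P * U * (Uᴴ * P * U) = Uᴴ * P * (U * Uᴴ) * P * U := by simp only [Matrix.mul_assoc]
      _ = Uᴴ * (P * P) * U := by rw [h2]; simp only [Matrix.mul_assoc, Matrix.one_mul]
      _ = _ := by rw [hPP]
  have hev : ∀ i, hP.eigenvalues i = 0 ∨ hP.eigenvalues i = 1 := fun i => by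
    have := congrFun (congrFun hDD i) i
    simp only [hD, diagonal_mul_diagonal, diagonal_apply_eq, Function.comp_apply] at this
    have h3 : hP.eigenvalues i * hP.eigenvalues i = hP.eigenvalues i := by exact_mod_cast this
    have h4 : hP.eigenvalues i * (hP.eigenvalues i - 1) = 0 := by linarith
    rcases mul_eq_zero.1 h4 with h | h
    · exact Or.inl h
    · exact Or.inr (by linarith)
  -- The columns of the isometry are the eigenvectors for the eigenvalue `1`.
  refine ⟨{i // hP.eigenvalues i = 1}, inferInstance, inferInstance, of fun a i => U a i, ?_, ?_⟩
  · ext i j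
    have := congrFun (congrFun h1 i.1) j.1
    rw [Matrix.mul_apply] at this ⊢
    simpa [Matrix.one_apply, Subtype.ext_iff] using this
  · ext a b
    conv_rhs => rw [hspec]
    rw [Matrix.mul_apply, Matrix.mul_apply]
    simp only [hD, Matrix.mul_diagonal, conjTranspose_apply, Function.comp_apply, of_apply]
    rw [← Finset.sum_subtype (Finset.univ.filter fun i => hP.eigenvalues i = 1) (by simp)
      (fun i => U a i * star (U b i)), Finset.sum_filter]
    refine Finset.sum_congr rfl fun i _ => ?_
    rcases hev i with h | h <;> simp [h]

/-- The multiplicity space is the range of `α (e v₀ v₀)`. The partial isometries `α (e v v₀)` carry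
an orthonormal basis of it to the columns indexed by `v`. -/
theorem exists_isKraus [Nonempty ι] (α : Matrix ι ι ℂ →⋆ₙₐ[ℂ] Matrix ι' ι' ℂ) :
    ∃ (κ : Type) (_ : Fintype κ) (_ : DecidableEq κ) (V : κ → Matrix ι' ι ℂ), IsKraus α V := by
  have v₀ : ι := Classical.arbitrary ι
  have hstar : ∀ x, (α x)ᴴ = α xᴴ := fun x => (map_star α x).symm
  obtain ⟨κ, h1, h2, W, hW1, hW2⟩ := exists_isometry_of_projection (P := α (single v₀ v₀ 1))
    (by rw [IsHermitian, hstar, conjTranspose_single, star_one])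
    (by rw [← map_mul, single_mul_single_same, mul_one])
  refine ⟨κ, h1, h2, fun k => of fun a v => (α (single v v₀ 1) * W) a k, ?_, ?_⟩
  · intro k l
    ext v w
    have : (α (single v v₀ 1) * W)ᴴ * (α (single w v₀ 1) * W) =
        if v = w then 1 else 0 := by
      rw [conjTranspose_mul, hstar, conjTranspose_single, Matrix.mul_assoc,
        ← Matrix.mul_assoc (α _) (α _), ← map_mul]
      split_ifs with h
      · subst h
        rw [single_mul_single_same, star_one, mul_one, ← hW2, Matrix.mul_assoc, hW1,
          Matrix.mul_one, hW1]
      · rw [single_mul_single_of_ne _ _ _ _ h]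
        simp
    have h := congrFun (congrFun this k) l
    rw [Matrix.mul_apply] at h ⊢
    simp only [conjTranspose_apply, of_apply] at h ⊢
    rw [h]
    split_ifs with h3 h4 h4 <;> simp [Matrix.one_apply, *]
  · intro x
    have h3 : ∀ v w, α (single v w 1) = (α (single v v₀ 1) * W) * (α (single w v₀ 1) * W)ᴴ := by
      intro v w
      rw [conjTranspose_mul, hstar, conjTranspose_single, Matrix.mul_assoc,
        ← Matrix.mul_assoc W, hW2, ← map_mul, ← map_mul, single_mul_single_same,
        single_mul_single_same]
      simp
    have h4 : ∀ v w, α (single v w (x v w)) =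
        x v w • ((α (single v v₀ 1) * W) * (α (single w v₀ 1) * W)ᴴ) := fun v w => by
      rw [← h3, ← map_smul, smul_single, smul_eq_mul, mul_one]
    conv_lhs => rw [matrix_eq_sum_single x]
    simp_rw [map_sum, h4]
    obtain ⟨Y, hY⟩ : ∃ Y : ι → Matrix ι' κ ℂ, ∀ v, Y v = α (single v v₀ 1) * W :=
      ⟨_, fun _ => rfl⟩
    simp_rw [← hY]
    ext a b
    simp only [Matrix.sum_apply, Matrix.smul_apply, smul_eq_mul, Matrix.mul_apply,
      conjTranspose_apply, of_apply, Finset.sum_mul, Finset.mul_sum]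
    symm
    rw [Finset.sum_comm]
    simp_rw [Finset.sum_comm (s := (Finset.univ : Finset κ))]
    rw [Finset.sum_comm]
    refine Finset.sum_congr rfl fun v _ => Finset.sum_congr rfl fun w _ =>
      Finset.sum_congr rfl fun k _ => ?_
    ring

end Kraus

end FourCycle
end

noncomputable section

namespace FourCycle

open Matrix

open scoped Kronecker

/-! ### Block symmetries and symbols -/

section Symbol

variable {n m p : Fin 4 → ℕ} {κ κ' : Type} [Fintype κ] [DecidableEq κ] [Fintype κ'] [DecidableEq κ']

/-- The matrix which is a scalar multiple of the identity on each block. -/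
def blockDiag (n : Fin 4 → ℕ) (d : Fin 4 → ℂ) : Mat n := diagonal fun v => d v.1

theorem blockDiag_mul (d e : Fin 4 → ℂ) :
    blockDiag n d * blockDiag n e = blockDiag n (fun i => d i * e i) := by
  simp [blockDiag]

theorem blockDiag_one : blockDiag n (fun _ => 1) = 1 := by
  simp [blockDiag]

theorem blockDiag_mul_apply {ν : Type} (d : Fin 4 → ℂ) (M : Matrix (Idx n) ν ℂ) (v : Idx n)
    (w : ν) :
    (blockDiag n d * M) v w = d v.1 * M v w := by
  simp [blockDiag]

theorem mul_blockDiag_apply {ν : Type} (d : Fin 4 → ℂ) (M : Matrix ν (Idx n) ℂ) (v : ν)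
    (w : Idx n) :
    (M * blockDiag n d) v w = M v w * d w.1 := by
  simp [blockDiag]

/-- The signs which distinguish the blocks `{0, 2}` from `{1, 3}`. -/
def jsign : Fin 4 → ℤ := ![1, -1, 1, -1]

/-- The signs which distinguish the sources `{0, 1}` of `D₄` from the ranges `{2, 3}`. -/
def gsign : Fin 4 → ℤ := ![1, 1, -1, -1]

/-- The block symmetry `diag(1, -1, 1, -1)`. -/
def blockSymm (n : Fin 4 → ℕ) : Mat n := blockDiag n fun i => (jsign i : ℂ)

theorem jsign_mul_self (i : Fin 4) : (jsign i : ℂ) * jsign i = 1 := by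
  fin_cases i <;> simp [jsign]

theorem blockSymm_mul_self : blockSymm n * blockSymm n = 1 := by
  simp only [blockSymm, blockDiag_mul, jsign_mul_self, blockDiag_one]

/-- `S` expresses the action of the block diagonal matrix `d` on the ranges of the family `V`. -/
def HasSymbol (V : κ → Matrix (Idx m) (Idx n) ℂ) (d : Fin 4 → ℂ)
    (S : Fin 4 → Matrix κ κ ℂ) : Prop :=
  ∀ l, blockDiag m d * V l = ∑ k, V k * blockDiag n (fun i => S i k l)

/-- The family `V` maps sources of `D₄` to sources and ranges to ranges. -/
def IsGraded (V : κ → Matrix (Idx m) (Idx n) ℂ) : Prop :=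
  ∀ k w v, V k w v ≠ 0 → gsign w.1 = gsign v.1

theorem gsign_eq_of_isSymmetry {σ : Equiv.Perm (Fin 4)} (h : IsSymmetry σ) (i : Fin 4) :
    gsign (σ i) = gsign i := by
  have key : ∀ σ : Equiv.Perm (Fin 4), (∀ i j, (i = j ∨ ((i = 0 ∨ i = 1) ∧ (j = 2 ∨ j = 3))) ↔
      (σ i = σ j ∨ ((σ i = 0 ∨ σ i = 1) ∧ (σ j = 2 ∨ σ j = 3)))) →
      ∀ i, gsign (σ i) = gsign i := by decide
  exact key σ h i

theorem jsign_of_isSymmetry {σ : Equiv.Perm (Fin 4)} (h : IsSymmetry σ) :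
    jsign (σ 1) = -jsign (σ 0) ∧ jsign (σ 3) = -jsign (σ 2) := by
  have key : ∀ σ : Equiv.Perm (Fin 4), (∀ i j, (i = j ∨ ((i = 0 ∨ i = 1) ∧ (j = 2 ∨ j = 3))) ↔
      (σ i = σ j ∨ ((σ i = 0 ∨ σ i = 1) ∧ (σ j = 2 ∨ σ j = 3)))) →
      jsign (σ 1) = -jsign (σ 0) ∧ jsign (σ 3) = -jsign (σ 2) := by decide
  exact key σ h

theorem edge_of_fst_eq {v w : Idx n} (h : v.1 = w.1) : edge n v w := Or.inl h

theorem star_single (v w : Idx n) : star (single v w (1 : ℂ)) = single w v 1 := by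
  rw [star_eq_conjTranspose, conjTranspose_single, star_one]

/-- Star homomorphisms which respect the 4-cycle algebras respect their diagonals. -/
theorem map_single_apply_eq_zero {α : Mat n →⋆ₙₐ[ℂ] Mat m}
    (hα : ∀ a ∈ cycleAlgebra n, α a ∈ cycleAlgebra m) {v w : Idx n} (h : v.1 = w.1) {x y : Idx m}
    (hxy : x.1 ≠ y.1) : α (single v w 1) x y = 0 := by
  by_cases h1 : edge m x y
  -- Between different blocks at most one direction is an edge. Since `e w v` also lies in the
  -- algebra, its image vanishes in the other direction; take adjoints.
  · have h2 : ¬ edge m y x := by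
      unfold edge D4 at *
      grind
    have h3 := hα _ (single_mem_cycleAlgebra 1 (edge_of_fst_eq h.symm)) y x h2
    rw [← star_single, map_star, star_apply, h3, star_zero]
  · exact hα _ (single_mem_cycleAlgebra 1 (edge_of_fst_eq h)) x y h1

theorem commute_blockDiag_map_single {α : Mat n →⋆ₙₐ[ℂ] Mat m}
    (hα : ∀ a ∈ cycleAlgebra n, α a ∈ cycleAlgebra m) {v w : Idx n} (h : v.1 = w.1)
    (d : Fin 4 → ℂ) : Commute (blockDiag m d) (α (single v w 1)) := by
  ext x y
  rw [blockDiag_mul_apply, mul_blockDiag_apply]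
  by_cases hxy : x.1 = y.1
  · rw [hxy, mul_comm]
  · rw [map_single_apply_eq_zero hα h hxy, mul_zero, zero_mul]

/-- The block diagonal matrix commutes with the image of each diagonal block, so its compression `(V
k)ᴴ * blockDiag m d * V l` commutes with the diagonal blocks and is scalar on each of them. -/
theorem exists_hasSymbol (hn : ∀ i, 0 < n i) {α : Mat n →⋆ₙₐ[ℂ] Mat m}
    (hα : ∀ a ∈ cycleAlgebra n, α a ∈ cycleAlgebra m) {V : κ → Matrix (Idx m) (Idx n) ℂ}
    (hV : IsKraus α V) (d : Fin 4 → ℂ) : ∃ S, HasSymbol V d S := by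
  let b : Fin 4 → Idx n := fun i => ⟨i, 0, hn i⟩
  have hone : Commute (blockDiag m d) (α 1) := by
    rw [← sum_single_one, map_sum]
    exact Commute.sum_right _ _ _ fun v _ => commute_blockDiag_map_single hα rfl d
  refine ⟨fun i => of fun k l => ((V k)ᴴ * blockDiag m d * V l) (b i) (b i), fun l => ?_⟩
  rw [hV.expand hone]
  refine Finset.sum_congr rfl fun k _ => congrArg _ ?_
  have hcomm : ∀ v w : Idx n, v.1 = w.1 →
      single v w 1 * ((V k)ᴴ * blockDiag m d * V l) =
        (V k)ᴴ * blockDiag m d * V l * single v w 1 := by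
    intro v w h
    rw [Matrix.mul_assoc, ← Matrix.mul_assoc, ← hV.conjTranspose_mul_map, Matrix.mul_assoc,
      ← Matrix.mul_assoc (α _), ← (commute_blockDiag_map_single hα h d).eq, Matrix.mul_assoc,
      hV.map_mul]
    simp only [Matrix.mul_assoc]
  simp only [of_apply]
  generalize (V k)ᴴ * blockDiag m d * V l = M at hcomm ⊢
  ext v w
  rw [blockDiag, diagonal_apply]
  split_ifs with hvw
  · subst hvw
    have := congrFun (congrFun (hcomm v (b v.1) rfl) v) (b v.1)
    simpa using this.symm
  · have := congrFun (congrFun (hcomm v v rfl) v) w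
    rw [mul_single_apply_of_ne _ _ _ _ _ (Ne.symm hvw)] at this
    simpa using this

namespace HasSymbol

variable {α : Mat n →⋆ₙₐ[ℂ] Mat m} {V : κ → Matrix (Idx m) (Idx n) ℂ} {d : Fin 4 → ℂ}
  {S : Fin 4 → Matrix κ κ ℂ}

theorem conjTranspose_mul (hS : HasSymbol V d S) (hV : IsKraus α V) (k l : κ) :
    (V k)ᴴ * (blockDiag m d * V l) = blockDiag n (fun i => S i k l) := by
  rw [hS, hV.sum_mul_cancel]

theorem apply_eq (hS : HasSymbol V d S) (hV : IsKraus α V) (v : Idx n) (k l : κ) :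
    S v.1 k l = ((V k)ᴴ * (blockDiag m d * V l)) v v := by
  rw [hS.conjTranspose_mul hV, blockDiag, diagonal_apply_eq]

theorem mul_self (hn : ∀ i, 0 < n i) (hV : IsKraus α V)
    (hS : HasSymbol V (fun i => (jsign i : ℂ)) S) (i : Fin 4) : S i * S i = 1 := by
  ext k l
  have h : (V k)ᴴ * (blockSymm m * (blockSymm m * V l)) = if k = l then 1 else 0 := by
    rw [← Matrix.mul_assoc (blockSymm m), blockSymm_mul_self, Matrix.one_mul, hV.orth]
  rw [show blockSymm m * V l = _ from hS l, Matrix.mul_sum, Matrix.mul_sum] at h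
  have h1 : ∀ k', (V k)ᴴ * (blockSymm m * (V k' * blockDiag n (fun i => S i k' l))) =
      blockDiag n (fun i => S i k k' * S i k' l) := fun k' => by
    rw [← blockDiag_mul, ← hS.conjTranspose_mul hV k k', blockSymm]
    simp only [Matrix.mul_assoc]
  simp_rw [h1] at h
  have h2 := congrFun (congrFun h ⟨i, 0, hn i⟩) ⟨i, 0, hn i⟩
  rw [Matrix.mul_apply, Matrix.one_apply]
  split_ifs at h2 ⊢ <;> simpa [Matrix.sum_apply, blockDiag] using h2

/-- A change of family by `u` changes the basis of the multiplicity space, hence conjugates the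
symbol. -/
theorem conj (hn : ∀ i, 0 < n i) {W : κ' → Matrix (Idx m) (Idx n) ℂ} {T : Fin 4 → Matrix κ' κ' ℂ}
    (hV : IsKraus α V) (hS : HasSymbol V d S) (hW : IsKraus α W) (hT : HasSymbol W d T)
    {u : Matrix κ κ' ℂ} (hu : ∀ l, W l = ∑ k, u k l • V k) (i : Fin 4) : T i = uᴴ * S i * u := by
  ext l l'
  let v : Idx n := ⟨i, 0, hn i⟩
  have h : (W l)ᴴ * (blockDiag m d * W l') = ∑ k', ∑ k, (star (u k l) * u k' l') •
      ((V k)ᴴ * (blockDiag m d * V k')) := by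
    rw [hu, hu, Matrix.mul_sum, Matrix.mul_sum]
    refine Finset.sum_congr rfl fun k' _ => ?_
    rw [conjTranspose_sum, Matrix.sum_mul]
    refine Finset.sum_congr rfl fun k _ => ?_
    rw [conjTranspose_smul, Matrix.mul_smul, Matrix.mul_smul, Matrix.smul_mul, smul_smul, mul_comm]
  rw [show T i l l' = _ from hT.apply_eq hW v l l', h]
  simp only [Matrix.sum_apply, Matrix.smul_apply, ← hS.apply_eq hV,
    Matrix.mul_apply, conjTranspose_apply, Finset.sum_mul, smul_eq_mul]
  refine Finset.sum_congr rfl fun k _ => Finset.sum_congr rfl fun k' _ => ?_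
  ring

end HasSymbol

/-! ### Graded families and the symbol of a composite. -/

theorem IsGraded.of_sum {V : κ → Matrix (Idx m) (Idx n) ℂ} {W : κ' → Matrix (Idx m) (Idx n) ℂ}
    (h : IsGraded V) {u : Matrix κ κ' ℂ} (hu : ∀ l, W l = ∑ k, u k l • V k) : IsGraded W := by
  intro l w v hne
  rw [hu, Matrix.sum_apply] at hne
  obtain ⟨k, -, hk⟩ := Finset.exists_ne_zero_of_sum_ne_zero hne
  exact h k w v fun h0 => hk (by rw [Matrix.smul_apply, h0, smul_zero])

theorem IsGraded.blockDiag_mul {V : κ → Matrix (Idx m) (Idx n) ℂ} (h : IsGraded V) {d : Fin 4 → ℂ}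
    (h01 : d 0 = d 1) (h23 : d 2 = d 3) (k : κ) :
    FourCycle.blockDiag m d * V k = V k * FourCycle.blockDiag n d := by
  ext w v
  rw [blockDiag_mul_apply, mul_blockDiag_apply]
  by_cases h0 : V k w v = 0
  · simp [h0]
  · have key : ∀ i j, gsign i = gsign j → d i = d j := by
      intro i j hij
      fin_cases i <;> fin_cases j <;> simp [gsign] at hij <;> simp [h01, h23]
    rw [key _ _ (h k w v h0), mul_comm]

theorem IsGraded.comp {V : κ → Matrix (Idx m) (Idx n) ℂ} {W : κ' → Matrix (Idx p) (Idx m) ℂ}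
    (hV : IsGraded V) (hW : IsGraded W) : IsGraded (fun q : κ × κ' => W q.2 * V q.1) := by
  intro q x v hne
  simp only [Matrix.mul_apply] at hne
  obtain ⟨w, -, hw⟩ := Finset.exists_ne_zero_of_sum_ne_zero hne
  exact (hW _ _ _ (left_ne_zero_of_mul hw)).trans (hV _ _ _ (right_ne_zero_of_mul hw))

/-- The sum part of a symbol. -/
def symbolEven (T : Fin 4 → Matrix κ κ ℂ) : Fin 4 → Matrix κ κ ℂ :=
  ![(2⁻¹ : ℂ) • (T 0 + T 1), (2⁻¹ : ℂ) • (T 0 + T 1), (2⁻¹ : ℂ) • (T 2 + T 3),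
    (2⁻¹ : ℂ) • (T 2 + T 3)]

/-- The difference part of a symbol. -/
def symbolOdd (T : Fin 4 → Matrix κ κ ℂ) : Fin 4 → Matrix κ κ ℂ :=
  ![(2⁻¹ : ℂ) • (T 0 - T 1), (2⁻¹ : ℂ) • (T 0 - T 1), (2⁻¹ : ℂ) • (T 2 - T 3),
    (2⁻¹ : ℂ) • (T 2 - T 3)]

/-- Within each of the pairs `{0, 1}` and `{2, 3}`, every function is a combination of `1` and
`jsign`; the coefficients are constant on the pair. -/
theorem symbolEven_add_symbolOdd (T : Fin 4 → Matrix κ κ ℂ) (i : Fin 4) (k l : κ) :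
    T i k l = symbolEven T i k l + symbolOdd T i k l * jsign i := by
  fin_cases i <;> simp [symbolEven, symbolOdd, jsign] <;> ring

/-- The even and odd parts of `T` do not separate the two sources or the two ranges, so they pass
unchanged through the graded family `V`. Only the factor `jsign` attached to the odd part acts on
`V`, and it contributes `S`. -/
theorem HasSymbol.comp {V : κ → Matrix (Idx m) (Idx n) ℂ} {W : κ' → Matrix (Idx p) (Idx m) ℂ}
    {S : Fin 4 → Matrix κ κ ℂ} {T : Fin 4 → Matrix κ' κ' ℂ} {d : Fin 4 → ℂ} (hgr : IsGraded V)
    (hS : HasSymbol V (fun i => (jsign i : ℂ)) S) (hT : HasSymbol W d T) :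
    HasSymbol (fun q : κ × κ' => W q.2 * V q.1) d
      (fun i => 1 ⊗ₖ symbolEven T i + S i ⊗ₖ symbolOdd T i) := by
  rintro ⟨a, b⟩
  have key : ∀ b', blockDiag m (fun i => T i b' b) * V a =
      ∑ a', V a' * blockDiag n
        (fun i => (1 ⊗ₖ symbolEven T i + S i ⊗ₖ symbolOdd T i : Matrix (κ × κ') (κ × κ') ℂ)
          (a', b') (a, b)) := by
    intro b'
    have h1 : blockDiag m (fun i => T i b' b) = blockDiag m (fun i => symbolEven T i b' b) +
        blockDiag m (fun i => symbolOdd T i b' b) * blockDiag m (fun i => (jsign i : ℂ)) := by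
      rw [FourCycle.blockDiag_mul]
      simp only [blockDiag, diagonal_add, ← symbolEven_add_symbolOdd]
    have h2 : ∀ a', blockDiag n
        (fun i => (1 ⊗ₖ symbolEven T i + S i ⊗ₖ symbolOdd T i : Matrix (κ × κ') (κ × κ') ℂ)
          (a', b') (a, b)) =
        (if a' = a then blockDiag n (fun i => symbolEven T i b' b) else 0) +
        blockDiag n (fun i => symbolOdd T i b' b) * blockDiag n (fun i => S i a' a) := by
      intro a'
      rw [FourCycle.blockDiag_mul]
      split_ifs with h
      · simp [blockDiag, h, diagonal_add, kroneckerMap_apply, mul_comm]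
      · simp [blockDiag, h, kroneckerMap_apply, mul_comm]
    rw [h1, Matrix.add_mul, Matrix.mul_assoc, hS a, Matrix.mul_sum,
      hgr.blockDiag_mul (by simp [symbolEven]) (by simp [symbolEven])]
    simp only [h2, Matrix.mul_add, Finset.sum_add_distrib]
    congr 1
    · refine ((Finset.sum_eq_single a (fun c _ hc => ?_) (by simp)).trans ?_).symm
      · rw [if_neg hc, Matrix.mul_zero]
      · rw [if_pos rfl]
    · refine Finset.sum_congr rfl fun a' _ => ?_
      rw [← Matrix.mul_assoc, ← Matrix.mul_assoc,
        hgr.blockDiag_mul (by simp [symbolOdd]) (by simp [symbolOdd])]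
  rw [← Matrix.mul_assoc, hT b, Matrix.sum_mul, Fintype.sum_prod_type_right]
  refine Finset.sum_congr rfl fun b' _ => ?_
  rw [Matrix.mul_assoc, key, Matrix.mul_sum]
  simp only [Matrix.mul_assoc]

end Symbol

end FourCycle
end

noncomputable section

namespace FourCycle

open Matrix

open scoped Kronecker

/-! ### Tensor products of symmetries -/

section Kronecker

variable {κ κ' : Type} [Fintype κ] [DecidableEq κ] [Fintype κ'] [DecidableEq κ']

theorem kronecker_eq_zero {A : Matrix κ κ ℂ} {B : Matrix κ' κ' ℂ} (h : A ⊗ₖ B = 0) :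
    A = 0 ∨ B = 0 := by
  by_contra! hne
  obtain ⟨i, j, hA⟩ : ∃ i j, A i j ≠ 0 := by
    by_contra! h0
    exact hne.1 (by ext; exact h0 _ _)
  obtain ⟨k, l, hB⟩ : ∃ i j, B i j ≠ 0 := by
    by_contra! h0
    exact hne.2 (by ext; exact h0 _ _)
  exact mul_ne_zero hA hB (congrFun (congrFun h (i, k)) (j, l))

/-- Put `X = S₀ + S₁`, `A = T₀ - T₁`, `B = T₀ + T₁`; the hypothesis says `X ⊗ A = -2 (1 ⊗ B)`. As
`A` and `B` anticommute, multiplying by `1 ⊗ A` on either side gives `X ⊗ A² = 0`. If `X = 0`, then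
`B = 0`. If `A² = 0`, then `B² = 4`, and squaring the relation is contradictory. -/
theorem eq_neg_of_kronecker_eq [Nonempty κ] [Nonempty κ'] {S₀ S₁ : Matrix κ κ ℂ}
    {T₀ T₁ : Matrix κ' κ' ℂ} (h₀ : T₀ * T₀ = 1) (h₁ : T₁ * T₁ = 1)
    (h : 1 ⊗ₖ ((2⁻¹ : ℂ) • (T₀ + T₁)) + S₁ ⊗ₖ ((2⁻¹ : ℂ) • (T₀ - T₁)) =
      -(1 ⊗ₖ ((2⁻¹ : ℂ) • (T₀ + T₁)) + S₀ ⊗ₖ ((2⁻¹ : ℂ) • (T₀ - T₁)))) :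
    S₁ = -S₀ ∧ T₁ = -T₀ := by
  have h1 : (S₀ + S₁) ⊗ₖ (T₀ - T₁) = (1 : Matrix κ κ ℂ) ⊗ₖ (-(2 : ℂ) • (T₀ + T₁)) := by
    simp only [kronecker_smul, add_kronecker] at h ⊢
    linear_combination (norm := module) (2 : ℂ) • h
  have hone : ∀ {B : Matrix κ' κ' ℂ}, (1 : Matrix κ κ ℂ) ⊗ₖ B = 0 → B = 0 := fun h =>
    (kronecker_eq_zero h).resolve_left one_ne_zero
  have hzero : (S₀ + S₁) ⊗ₖ ((T₀ - T₁) * (T₀ - T₁)) = 0 := by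
    have h2 : (S₀ + S₁) ⊗ₖ ((T₀ - T₁) * (T₀ - T₁)) =
        (1 : Matrix κ κ ℂ) ⊗ₖ ((-(2 : ℂ) • (T₀ + T₁)) * (T₀ - T₁)) := by
      have := congrArg (fun M => M * ((1 : Matrix κ κ ℂ) ⊗ₖ (T₀ - T₁))) h1
      simpa only [← mul_kronecker_mul, Matrix.mul_one] using this
    have h3 : (S₀ + S₁) ⊗ₖ ((T₀ - T₁) * (T₀ - T₁)) =
        (1 : Matrix κ κ ℂ) ⊗ₖ ((T₀ - T₁) * (-(2 : ℂ) • (T₀ + T₁))) := by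
      have := congrArg (fun M => ((1 : Matrix κ κ ℂ) ⊗ₖ (T₀ - T₁)) * M) h1
      simpa only [← mul_kronecker_mul, Matrix.one_mul] using this
    have h4 : (-(2 : ℂ) • (T₀ + T₁)) * (T₀ - T₁) = -((T₀ - T₁) * (-(2 : ℂ) • (T₀ + T₁))) := by
      simp only [Matrix.smul_mul, Matrix.mul_smul, ← smul_neg]
      congr 1
      simp only [Matrix.mul_add, Matrix.add_mul, Matrix.mul_sub, Matrix.sub_mul, h₀, h₁]
      module
    have h5 : (2 : ℂ) • ((S₀ + S₁) ⊗ₖ ((T₀ - T₁) * (T₀ - T₁))) = 0 := by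
      rw [two_smul]
      nth_rewrite 1 [h2]
      rw [h3, h4, ← kronecker_add, neg_add_cancel, kronecker_zero]
    exact (smul_eq_zero.1 h5).resolve_left two_ne_zero
  rcases kronecker_eq_zero hzero with hX | hA
  · rw [hX, zero_kronecker] at h1
    have := (smul_eq_zero.1 (hone h1.symm)).resolve_left (by norm_num)
    exact ⟨eq_neg_of_add_eq_zero_right hX, eq_neg_of_add_eq_zero_right this⟩
  · exfalso
    have h2 : (T₀ + T₁) * (T₀ + T₁) = (4 : ℂ) • 1 := by
      simp only [Matrix.mul_add, Matrix.add_mul, Matrix.mul_sub, Matrix.sub_mul, h₀, h₁] at hA ⊢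
      linear_combination (norm := module) -hA
    have h3 := congrArg (fun M => M * M) h1
    simp only [← mul_kronecker_mul, hA, kronecker_zero, Matrix.mul_one, Matrix.smul_mul,
      Matrix.mul_smul, h2] at h3
    have h4 := hone h3.symm
    simp only [smul_smul] at h4
    exact one_ne_zero ((smul_eq_zero.1 h4).resolve_left (by norm_num))

/-- The matrix `(1 + M) / 2` is idempotent, so its trace is its rank. -/
theorem exists_int_trace_eq {M : Matrix κ κ ℂ} (h : M * M = 1) : ∃ z : ℤ, M.trace = z := by
  let P : Matrix κ κ ℂ := (2⁻¹ : ℂ) • (1 + M)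
  have hP : IsIdempotentElem P := by
    simp only [IsIdempotentElem, P, Matrix.smul_mul, Matrix.mul_smul, Matrix.mul_add,
      Matrix.add_mul, h, Matrix.mul_one, Matrix.one_mul]
    module
  have hproj := LinearMap.isProj_range_iff_isIdempotentElem (toLin' P) |>.2
    (by rw [IsIdempotentElem, Module.End.mul_eq_comp, ← toLin'_mul]; exact congrArg _ hP)
  have h1 := hproj.trace
  rw [trace_toLin'_eq, trace_smul, trace_add, trace_one] at h1
  refine ⟨2 * Module.finrank ℂ (LinearMap.range (toLin' P)) - Fintype.card κ, ?_⟩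
  push_cast
  rw [← h1, smul_eq_mul]
  ring

/-- If the trace is nonzero, compare `AB ⊗ CD = BA ⊗ DC` at a nonzero entry of `CD`. Since `AB` and
`BA` have equal traces, the two scalars agree, so `A` and `B` commute and `AB` is an involution. -/
theorem exists_int_trace_eq_of_kronecker [Nonempty κ'] {A B : Matrix κ κ ℂ} {C D : Matrix κ' κ' ℂ}
    (hA : A * A = 1) (hB : B * B = 1) (hC : C * C = 1) (hD : D * D = 1)
    (h : (A ⊗ₖ C) * (B ⊗ₖ D) = (B ⊗ₖ D) * (A ⊗ₖ C)) : ∃ z : ℤ, (A * B).trace = z := by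
  rw [← mul_kronecker_mul, ← mul_kronecker_mul] at h
  by_cases ht : (A * B).trace = 0
  · exact ⟨0, by simp [ht]⟩
  have hCD : C * D ≠ 0 := fun h0 => by
    have : C * (C * D) * D = 1 := by
      rw [← Matrix.mul_assoc, hC, Matrix.one_mul, hD]
    rw [h0] at this
    simp at this
  obtain ⟨k, l, hkl⟩ : ∃ k l, (C * D) k l ≠ 0 := by
    by_contra! h0
    exact hCD (by ext; exact h0 _ _)
  have hsc : (C * D) k l • (A * B) = (D * C) k l • (B * A) := by
    ext i j
    have := congrFun (congrFun h (i, k)) (j, l)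
    simpa [kroneckerMap_apply, mul_comm] using this
  have hc : (C * D) k l = (D * C) k l := by
    have := congrArg trace hsc
    rw [trace_smul, trace_smul, trace_mul_comm B A] at this
    exact mul_right_cancel₀ ht this
  rw [← hc] at hsc
  have hcomm : A * B = B * A := smul_right_injective _ hkl hsc
  refine exists_int_trace_eq ?_
  calc A * B * (A * B) = A * B * (B * A) := by rw [hcomm]
    _ = A * (B * B) * A := by simp only [Matrix.mul_assoc]
    _ = 1 := by rw [hB, Matrix.mul_one, hA]

end Kronecker

/-! ### Winding numbers of star homomorphisms -/

section Winding

variable {n m p : Fin 4 → ℕ} {κ κ' : Type} [Fintype κ] [DecidableEq κ] [Fintype κ'] [DecidableEq κ']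

/-- The star homomorphism implemented by `V` is graded, and its symbol for the block symmetry is
compatible with the block symmetry. -/
structure IsAligned (α : Mat n →⋆ₙₐ[ℂ] Mat m) (V : κ → Matrix (Idx m) (Idx n) ℂ)
    (S : Fin 4 → Matrix κ κ ℂ) : Prop where
  kraus : IsKraus α V
  graded : IsGraded V
  symbol : HasSymbol V (fun i => (jsign i : ℂ)) S
  neg_source : S 1 = -S 0
  neg_range : S 3 = -S 2

/-- The winding number of an aligned star homomorphism. -/
def HasWinding (α : Mat n →⋆ₙₐ[ℂ] Mat m) (t : ℂ) : Prop :=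
  ∃ (κ : Type) (_ : Fintype κ) (_ : DecidableEq κ) (V : κ → Matrix (Idx m) (Idx n) ℂ)
    (S : Fin 4 → Matrix κ κ ℂ), IsAligned α V S ∧ (S 0 * S 2).trace = t

/-- Aligned star homomorphisms whose symbol is commutative. -/
def IsRegular (α : Mat n →⋆ₙₐ[ℂ] Mat m) : Prop :=
  ∃ (κ : Type) (_ : Fintype κ) (_ : DecidableEq κ) (V : κ → Matrix (Idx m) (Idx n) ℂ)
    (S : Fin 4 → Matrix κ κ ℂ), IsAligned α V S ∧ S 0 * S 2 = S 2 * S 0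

theorem IsAligned.id : IsAligned (NonUnitalStarAlgHom.id ℂ (Mat n))
    (fun _ : Unit => (1 : Mat n)) (fun i => (jsign i : ℂ) • 1) where
  kraus := IsKraus.id
  graded k w v h := by
    by_cases hwv : w = v
    · rw [hwv]
    · exact absurd (one_apply_ne hwv) h
  symbol l := by simp
  neg_source := by simp [jsign]
  neg_range := by simp [jsign]

theorem IsRegular.id : IsRegular (NonUnitalStarAlgHom.id ℂ (Mat n)) :=
  ⟨_, _, _, _, _, IsAligned.id, by simp [jsign]⟩

theorem HasWinding.id : HasWinding (NonUnitalStarAlgHom.id ℂ (Mat n)) 1 :=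
  ⟨_, _, _, _, _, IsAligned.id, by simp [jsign]⟩

/-- The sign relations kill the even part of `T`, which leaves a pure Kronecker product as the
symbol of the composite. -/
theorem IsAligned.comp {α : Mat n →⋆ₙₐ[ℂ] Mat m} {β : Mat m →⋆ₙₐ[ℂ] Mat p}
    {V : κ → Matrix (Idx m) (Idx n) ℂ} {W : κ' → Matrix (Idx p) (Idx m) ℂ}
    {S : Fin 4 → Matrix κ κ ℂ} {T : Fin 4 → Matrix κ' κ' ℂ}
    (hβ : IsAligned β W T) (hα : IsAligned α V S) :
    IsAligned (β.comp α) (fun q : κ × κ' => W q.2 * V q.1) (fun i => S i ⊗ₖ symbolOdd T i) where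
  kraus := hβ.kraus.comp hα.kraus
  graded := hα.graded.comp hβ.graded
  symbol := by
    have h0 : ∀ i, symbolEven T i = 0 := by
      intro i
      fin_cases i <;> simp [symbolEven, hβ.neg_source, hβ.neg_range]
    simpa [h0] using hα.symbol.comp hα.graded hβ.symbol
  neg_source := by
    rw [hα.neg_source]
    ext
    simp [symbolOdd]
  neg_range := by
    rw [hα.neg_range]
    ext
    simp [symbolOdd]

theorem IsAligned.symbolOdd_eq {β : Mat n →⋆ₙₐ[ℂ] Mat m} {W : κ → Matrix (Idx m) (Idx n) ℂ}
    {T : Fin 4 → Matrix κ κ ℂ} (hβ : IsAligned β W T) :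
    symbolOdd T 0 = T 0 ∧ symbolOdd T 2 = T 2 := by
  simp only [symbolOdd, hβ.neg_source, hβ.neg_range]
  constructor
  · change (2⁻¹ : ℂ) • (T 0 - -T 0) = T 0
    module
  · change (2⁻¹ : ℂ) • (T 2 - -T 2) = T 2
    module

theorem HasWinding.comp {α : Mat n →⋆ₙₐ[ℂ] Mat m} {β : Mat m →⋆ₙₐ[ℂ] Mat p} {s t : ℂ}
    (hβ : HasWinding β t) (hα : HasWinding α s) : HasWinding (β.comp α) (t * s) := by
  obtain ⟨κ, _, _, V, S, h, rfl⟩ := hα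
  obtain ⟨κ', _, _, W, T, h', rfl⟩ := hβ
  refine ⟨_, _, _, _, _, h'.comp h, ?_⟩
  rw [h'.symbolOdd_eq.1, h'.symbolOdd_eq.2, ← mul_kronecker_mul, trace_kronecker, mul_comm]

theorem IsRegular.comp {α : Mat n →⋆ₙₐ[ℂ] Mat m} {β : Mat m →⋆ₙₐ[ℂ] Mat p}
    (hβ : IsRegular β) (hα : IsRegular α) : IsRegular (β.comp α) := by
  obtain ⟨κ, _, _, V, S, h, hc⟩ := hα
  obtain ⟨κ', _, _, W, T, h', hc'⟩ := hβ
  refine ⟨_, _, _, _, _, h'.comp h, ?_⟩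
  rw [h'.symbolOdd_eq.1, h'.symbolOdd_eq.2, ← mul_kronecker_mul, ← mul_kronecker_mul, hc, hc']

/-- Two families give unitarily conjugate symbols, and the trace is invariant under conjugation. -/
theorem HasWinding.unique (hn : ∀ i, 0 < n i) {α : Mat n →⋆ₙₐ[ℂ] Mat m} {s t : ℂ}
    (hs : HasWinding α s) (ht : HasWinding α t) : s = t := by
  obtain ⟨κ, _, _, V, S, h, rfl⟩ := hs
  obtain ⟨κ', _, _, W, T, h', rfl⟩ := ht
  have : Nonempty (Idx n) := ⟨⟨0, 0, hn 0⟩⟩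
  obtain ⟨u, -, hu, hW, -⟩ := h.kraus.exists_unitary h'.kraus
  rw [h.symbol.conj hn h.kraus h'.kraus h'.symbol hW,
    h.symbol.conj hn h.kraus h'.kraus h'.symbol hW]
  have : uᴴ * S 0 * u * (uᴴ * S 2 * u) = uᴴ * (S 0 * (u * uᴴ) * S 2 * u) := by
    simp only [Matrix.mul_assoc]
  rw [this, hu, trace_mul_comm uᴴ, Matrix.mul_one, Matrix.mul_assoc, hu, Matrix.mul_one]

theorem nonempty_of_injective (hn : ∀ i, 0 < n i) {α : Mat n →⋆ₙₐ[ℂ] Mat m}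
    {V : κ → Matrix (Idx m) (Idx n) ℂ} (hV : IsKraus α V) (hinj : Function.Injective α) :
    Nonempty κ := by
  by_contra hne
  rw [not_nonempty_iff] at hne
  have : Nonempty (Idx n) := ⟨⟨0, 0, hn 0⟩⟩
  have h1 : α 1 = α 0 := by
    rw [hV.form, hV.form, Finset.univ_eq_empty, Finset.sum_empty, Finset.sum_empty]
  exact one_ne_zero (hinj h1)

/-! ### Factors of regular homomorphisms. -/

/-- The rows of a Kraus family in a source block meet the columns of source blocks. -/
theorem exists_ne_zero_of_source {α : Mat n →⋆ₙₐ[ℂ] Mat m}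
    (hα : ∀ a ∈ cycleAlgebra n, α a ∈ cycleAlgebra m) {V : κ → Matrix (Idx m) (Idx n) ℂ}
    (hV : IsKraus α V) {a : κ} {w : Idx m} {v v₀ : Idx n} (hne : V a w v ≠ 0)
    (hw : w.1 = 0 ∨ w.1 = 1) (hv : edge n v₀ v) : ∃ a' w', w'.1 = w.1 ∧ V a' w' v₀ ≠ 0 := by
  by_contra! h0
  -- Rows in the block of `w` vanish by assumption; the others vanish because no edge enters a
  -- source block from another block.
  have hM : ∀ w', α (single v₀ v 1) w' w = 0 := by
    intro w'
    by_cases hww : w'.1 = w.1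
    · rw [hV.form, Matrix.sum_apply]
      refine Finset.sum_eq_zero fun k _ => ?_
      rw [Matrix.mul_apply]
      refine Finset.sum_eq_zero fun x _ => ?_
      have : (V k * single v₀ v (1 : ℂ)) w' x = V k w' v₀ * (single v₀ v (1 : ℂ)) v₀ x := by
        rw [Matrix.mul_apply]
        refine Finset.sum_eq_single _ (fun y _ hy => ?_) (by simp)
        rw [single_apply, if_neg (fun h => hy h.1.symm), mul_zero]
      rw [this, h0 k w' hww, zero_mul, zero_mul]
    · refine hα _ (single_mem_cycleAlgebra 1 hv) w' w fun h => ?_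
      unfold edge D4 at h
      grind
  have h1 := congrFun (congrFun (hV.conjTranspose_mul_map (single v₀ v 1) a) v₀) w
  rw [Matrix.mul_apply, Finset.sum_eq_zero (fun w' _ => by rw [hM, mul_zero]),
    single_mul_apply_same, one_mul, conjTranspose_apply, eq_comm, star_eq_zero] at h1
  exact hne h1

/-- The rows of a Kraus family in a range block meet the columns of range blocks. -/
theorem exists_ne_zero_of_range {α : Mat n →⋆ₙₐ[ℂ] Mat m}
    (hα : ∀ a ∈ cycleAlgebra n, α a ∈ cycleAlgebra m) {V : κ → Matrix (Idx m) (Idx n) ℂ}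
    (hV : IsKraus α V) {a : κ} {w : Idx m} {v v₀ : Idx n} (hne : V a w v ≠ 0)
    (hw : w.1 = 2 ∨ w.1 = 3) (hv : edge n v v₀) : ∃ a' w', w'.1 = w.1 ∧ V a' w' v₀ ≠ 0 := by
  by_contra! h0
  have hM : ∀ w', α (single v v₀ 1) w w' = 0 := by
    intro w'
    by_cases hww : w'.1 = w.1
    · rw [hV.form, Matrix.sum_apply]
      refine Finset.sum_eq_zero fun k _ => ?_
      rw [Matrix.mul_assoc, Matrix.mul_apply]
      refine Finset.sum_eq_zero fun x _ => ?_
      have : (single v v₀ (1 : ℂ) * (V k)ᴴ) x w' = (single v v₀ (1 : ℂ)) x v₀ * (V k)ᴴ v₀ w' := by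
        rw [Matrix.mul_apply]
        refine Finset.sum_eq_single _ (fun y _ hy => ?_) (by simp)
        rw [single_apply, if_neg (fun h => hy h.2.symm), zero_mul]
      rw [this, conjTranspose_apply, h0 k w' hww, star_zero, mul_zero, mul_zero]
    · refine hα _ (single_mem_cycleAlgebra 1 hv) w w' fun h => ?_
      unfold edge D4 at h
      grind
  have h1 := congrFun (congrFun (hV.map_mul (single v v₀ 1) a) w) v₀
  rw [Matrix.mul_apply, Finset.sum_eq_zero (fun w' _ => by rw [hM, zero_mul]),
    mul_single_apply_same, mul_one] at h1
  exact hne h1.symm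

/-- Let `γ` be the symbol of `gsign` for `β`. As the composite is graded, a nonzero entry `V a w v`
forces `γ w.1 b b = gsign v.1`, so the grade of `v` depends only on the block of `w`. A source block
meeting a range column, or the reverse, would also meet a column of its own grade, and the two signs
would clash. -/
theorem isGraded_of_comp (hn : ∀ i, 0 < n i) (hm : ∀ i, 0 < m i) {α : Mat n →⋆ₙₐ[ℂ] Mat m}
    {β : Mat m →⋆ₙₐ[ℂ] Mat p} (hα : ∀ a ∈ cycleAlgebra n, α a ∈ cycleAlgebra m)
    (hβ : ∀ a ∈ cycleAlgebra m, β a ∈ cycleAlgebra p) {V : κ → Matrix (Idx m) (Idx n) ℂ}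
    {W : κ' → Matrix (Idx p) (Idx m) ℂ} (hV : IsKraus α V) (hW : IsKraus β W) [Nonempty κ']
    (h : IsGraded (fun q : κ × κ' => W q.2 * V q.1)) : IsGraded V := by
  obtain ⟨γ, hγ⟩ := exists_hasSymbol hm hβ hW (fun i => (gsign i : ℂ))
  let b : κ' := Classical.arbitrary κ'
  have key : ∀ a w v, V a w v ≠ 0 → γ w.1 b b = gsign v.1 := by
    intro a w v hne
    have h1 : blockDiag m (fun i => γ i b b) * V a =
        V a * blockDiag n (fun i => (gsign i : ℂ)) := by
      rw [← hγ.conjTranspose_mul hW, Matrix.mul_assoc, Matrix.mul_assoc,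
        h.blockDiag_mul (d := fun i => (gsign i : ℂ)) rfl rfl (a, b)]
      rw [← Matrix.mul_assoc, ← Matrix.mul_assoc, hW.orth, if_pos rfl, Matrix.one_mul]
    have h2 := congrFun (congrFun h1 w) v
    rw [blockDiag_mul_apply, mul_blockDiag_apply, mul_comm] at h2
    exact mul_left_cancel₀ hne h2
  have hne1 : ((1 : ℤ) : ℂ) ≠ ((-1 : ℤ) : ℂ) := by norm_num
  intro a w v hne
  have hcases : ∀ i : Fin 4,
      ((i = 0 ∨ i = 1) ∧ gsign i = 1) ∨ ((i = 2 ∨ i = 3) ∧ gsign i = -1) := by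
    decide
  rcases hcases w.1 with ⟨hw, hw'⟩ | ⟨hw, hw'⟩ <;> rcases hcases v.1 with ⟨hv, hv'⟩ | ⟨hv, hv'⟩
  · rw [hw', hv']
  · obtain ⟨a', w', h1, h2⟩ := exists_ne_zero_of_source hα hV (v₀ := ⟨0, 0, hn 0⟩) hne hw
      (Or.inr ⟨Or.inl rfl, hv⟩)
    have h3 := key _ _ _ hne
    have h4 := key _ _ _ h2
    rw [h1, h3, hv'] at h4
    exact absurd h4.symm hne1
  · obtain ⟨a', w', h1, h2⟩ := exists_ne_zero_of_range hα hV (v₀ := ⟨2, 0, hn 2⟩) hne hw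
      (Or.inr ⟨hv, Or.inl rfl⟩)
    have h3 := key _ _ _ hne
    have h4 := key _ _ _ h2
    rw [h1, h3, hv'] at h4
    exact absurd h4 hne1
  · rw [hw', hv']

/-- A factor of a regular star homomorphism has an integral winding number. -/
theorem exists_hasWinding_of_comp (hn : ∀ i, 0 < n i) (hm : ∀ i, 0 < m i) {α : Mat n →⋆ₙₐ[ℂ] Mat m}
    {β : Mat m →⋆ₙₐ[ℂ] Mat p} (hα : ∀ a ∈ cycleAlgebra n, α a ∈ cycleAlgebra m)
    (hβ : ∀ a ∈ cycleAlgebra m, β a ∈ cycleAlgebra p) (hαi : Function.Injective α)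
    (hβi : Function.Injective β) (h : IsRegular (β.comp α)) : ∃ z : ℤ, HasWinding α z := by
  have : Nonempty (Idx n) := ⟨⟨0, 0, hn 0⟩⟩
  have : Nonempty (Idx m) := ⟨⟨0, 0, hm 0⟩⟩
  obtain ⟨κ, _, _, V, hV⟩ := exists_isKraus α
  obtain ⟨κ', _, _, W, hW⟩ := exists_isKraus β
  have := nonempty_of_injective hn hV hαi
  have := nonempty_of_injective hm hW hβi
  obtain ⟨κ₀, _, _, V₀, S₀, h₀, hcomm⟩ := h
  obtain ⟨u, -, hu, hVW, -⟩ := h₀.kraus.exists_unitary (hW.comp hV)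
  have hgr : IsGraded V := isGraded_of_comp hn hm hα hβ hV hW (h₀.graded.of_sum hVW)
  obtain ⟨S, hS⟩ := exists_hasSymbol hn hα hV (fun i => (jsign i : ℂ))
  obtain ⟨T, hT⟩ := exists_hasSymbol hm hβ hW (fun i => (jsign i : ℂ))
  -- The product family and the regular family implement the same composite, so the Kronecker
  -- formula for its symbol is unitarily conjugate to `S₀`.
  have hR := h₀.symbol.conj hn h₀.kraus (hW.comp hV) (hS.comp hgr hT) hVW
  have hT2 := fun i => hT.mul_self hm hW i
  have hS2 := fun i => hS.mul_self hn hV i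
  obtain ⟨hS1, hT1⟩ : S 1 = -S 0 ∧ T 1 = -T 0 := by
    refine eq_neg_of_kronecker_eq (hT2 0) (hT2 1) ?_
    have h1 := hR 1
    rw [h₀.neg_source, Matrix.mul_neg, Matrix.neg_mul, ← hR 0] at h1
    exact h1
  obtain ⟨hS3, hT3⟩ : S 3 = -S 2 ∧ T 3 = -T 2 := by
    refine eq_neg_of_kronecker_eq (hT2 2) (hT2 3) ?_
    have h1 := hR 3
    rw [h₀.neg_range, Matrix.mul_neg, Matrix.neg_mul, ← hR 2] at h1
    exact h1
  have hR' : ∀ i, i = 0 ∨ i = 2 → S i ⊗ₖ T i = uᴴ * S₀ i * u := by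
    intro i hi
    rw [← hR i]
    have h1 : symbolEven T i = 0 := by
      rcases hi with rfl | rfl <;> simp [symbolEven, hT1, hT3]
    have h2 : symbolOdd T i = T i := by
      rcases hi with rfl | rfl <;> simp only [symbolOdd, hT1, hT3]
      · change (2⁻¹ : ℂ) • (T 0 - -T 0) = T 0
        module
      · change (2⁻¹ : ℂ) • (T 2 - -T 2) = T 2
        module
    rw [h1, h2, kronecker_zero, zero_add]
  -- `S 0` and `S 2` need not commute; only their Kronecker products with `T 0` and `T 2` do, since
  -- these are conjugate to the commuting `S₀ 0` and `S₀ 2`.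
  obtain ⟨z, hz⟩ : ∃ z : ℤ, (S 0 * S 2).trace = z := by
    refine exists_int_trace_eq_of_kronecker (hS2 0) (hS2 2) (hT2 0) (hT2 2) ?_
    rw [hR' 0 (Or.inl rfl), hR' 2 (Or.inr rfl)]
    have h1 : ∀ A B : Matrix κ₀ κ₀ ℂ, uᴴ * A * u * (uᴴ * B * u) = uᴴ * (A * B) * u := by
      intro A B
      calc uᴴ * A * u * (uᴴ * B * u) = uᴴ * A * (u * uᴴ) * B * u := by simp only [Matrix.mul_assoc]
        _ = _ := by rw [hu, Matrix.mul_one, Matrix.mul_assoc uᴴ]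
    rw [h1, h1, hcomm]
  exact ⟨z, κ, _, _, V, S, ⟨hV, hgr, hS, hS1, hS3⟩, hz⟩

end Winding

/-! ### Rigid embeddings -/

section Rigid

variable {n m : Fin 4 → ℕ} {α : StarEmbedding n m}

/-- The isometry which implements a multiplicity one map. -/
def embIsometry (f : Idx n → Idx m) : Matrix (Idx m) (Idx n) ℂ :=
  of fun w v => if w = f v then 1 else 0

theorem embIsometry_mul_mul (f : Idx n → Idx m) (x : Mat n) :
    embIsometry f * x * (embIsometry f)ᴴ = multOne f x := by
  ext a b
  simp only [multOne, Matrix.sum_apply, single_apply, Matrix.mul_apply, embIsometry, of_apply,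
    conjTranspose_apply, Finset.sum_mul]
  rw [Finset.sum_comm]
  refine Finset.sum_congr rfl fun v _ => Finset.sum_congr rfl fun w _ => ?_
  by_cases h1 : a = f v <;> by_cases h2 : b = f w <;> simp [h1, h2, eq_comm]

/-- The sign of the action of a symmetry of `D₄` on homology. -/
def symmSign (σ : Equiv.Perm (Fin 4)) : ℤ := jsign (σ 0) * jsign (σ 2)

/-- The unitary `u` is block diagonal, since both it and its adjoint lie in the algebra, so it
commutes with the block symmetry. On the `s`-th summand over block `i` that symmetry is therefore
the sign of block `D.type s i`. A symmetry of `D4` preserves each of the pairs `{0, 1}` and `{2,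
3}`, which gives the sign relations. -/
theorem RigidDecomposition.isAligned (D : RigidDecomposition α) :
    IsAligned α.toHom (fun s => D.u * embIsometry (D.emb s))
      (fun i => diagonal fun s => (jsign (D.type s i) : ℂ)) := by
  have hu : star D.u * D.u = 1 := (Unitary.mem_iff.1 D.u_unitary).1
  have hblock : ∀ x y : Idx m, x.1 ≠ y.1 → D.u x y = 0 := by
    intro x y hxy
    by_cases h1 : edge m x y
    · have h2 : ¬ edge m y x := by
        unfold edge D4 at *
        grind
      have h3 := D.star_u_mem y x h2
      rwa [star_apply, star_eq_zero] at h3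
    · exact D.u_mem x y h1
  refine ⟨⟨?_, ?_⟩, ?_, ?_, ?_, ?_⟩
  · intro s t
    have : (D.u * embIsometry (D.emb s))ᴴ * (D.u * embIsometry (D.emb t)) =
        (embIsometry (D.emb s))ᴴ * (star D.u * D.u) * embIsometry (D.emb t) := by
      simp [Matrix.mul_assoc, star_eq_conjTranspose]
    rw [this, hu, Matrix.mul_one]
    ext v w
    have h1 : D.emb s v = D.emb t w ↔ s = t ∧ v = w := by
      rw [← Prod.mk.injEq]
      exact D.emb_injective.eq_iff (a := (s, v)) (b := (t, w))
    have h2 : ((embIsometry (D.emb s))ᴴ * embIsometry (D.emb t)) v w =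
        if D.emb s v = D.emb t w then 1 else 0 := by
      rw [Matrix.mul_apply]
      simp [embIsometry, eq_comm]
    rw [h2]
    simp only [h1]
    by_cases hst : s = t <;> simp [hst, Matrix.one_apply]
  · intro x
    rw [D.map_eq, Matrix.mul_sum, Matrix.sum_mul]
    refine Finset.sum_congr rfl fun s _ => ?_
    rw [← embIsometry_mul_mul]
    simp [Matrix.mul_assoc, star_eq_conjTranspose]
  · intro s w v hne
    have h1 : (D.u * embIsometry (D.emb s)) w v = D.u w (D.emb s v) := by
      rw [Matrix.mul_apply]
      simp [embIsometry]
    simp only [h1] at hne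
    have h2 : w.1 = (D.emb s v).1 := by
      by_contra h
      exact hne (hblock _ _ h)
    rw [h2, D.emb_block, gsign_eq_of_isSymmetry (D.type_isSymmetry s)]
  · intro s
    ext w v
    have h1 : (D.u * embIsometry (D.emb s)) w v = D.u w (D.emb s v) := by
      rw [Matrix.mul_apply]
      simp [embIsometry]
    rw [blockDiag_mul_apply, Matrix.sum_apply, Finset.sum_eq_single s]
    · rw [mul_blockDiag_apply]
      simp only [diagonal_apply_eq, h1]
      rw [← D.emb_block, mul_comm]
      by_cases h2 : w.1 = (D.emb s v).1
      · rw [h2]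
      · rw [hblock _ _ h2, zero_mul, zero_mul]
    · intro t _ hts
      rw [mul_blockDiag_apply]
      simp only [diagonal_apply_ne _ hts, mul_zero]
    · simp
  · ext s t
    simp [diagonal_apply, (jsign_of_isSymmetry (D.type_isSymmetry s)).1]
    split_ifs <;> simp
  · ext s t
    simp [diagonal_apply, (jsign_of_isSymmetry (D.type_isSymmetry s)).2]
    split_ifs <;> simp

theorem RigidDecomposition.hasWinding (D : RigidDecomposition α) :
    HasWinding α.toHom ((∑ s, symmSign (D.type s) : ℤ) : ℂ) :=
  ⟨_, _, _, _, _, D.isAligned, by simp [symmSign, trace_diagonal]⟩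

theorem RigidDecomposition.isRegular (D : RigidDecomposition α) : IsRegular α.toHom :=
  ⟨_, _, _, _, _, D.isAligned, by simp [mul_comm]⟩

end Rigid

end FourCycle
end

noncomputable section

namespace FourCycle

/-! ### The first homology group of a 4-cycle algebra -/

section Homology

variable {n m : Fin 4 → ℕ}

/-- Vertices which span a simplex. -/
def Adjacent {V : Type} (r : V → V → Prop) (x y : V) : Prop := x = y ∨ r x y ∨ r y x

theorem Adjacent.refl {V : Type} {r : V → V → Prop} (x : V) : Adjacent r x x := Or.inl rfl

theorem Adjacent.symm {V : Type} {r : V → V → Prop} {x y : V} (h : Adjacent r x y) :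
    Adjacent r y x := by
  unfold Adjacent at *
  tauto

/-- The oriented segment joining two adjacent vertices, as a 1-simplex. -/
def segment {V : Type} {r : V → V → Prop} {x y : V} (h : Adjacent r x y) : Simplex r 1 :=
  ⟨![x, y], fun a b => by
    fin_cases a <;> fin_cases b
    · exact Adjacent.refl _
    · exact h
    · exact h.symm
    · exact Adjacent.refl _⟩

/-- The 2-simplex spanned by three pairwise adjacent vertices. -/
def triangle {V : Type} {r : V → V → Prop} {x y z : V} (hxy : Adjacent r x y)
    (hyz : Adjacent r y z) (hxz : Adjacent r x z) : Simplex r 2 :=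
  ⟨![x, y, z], fun a b => by
    fin_cases a <;> fin_cases b
    · exact Adjacent.refl _
    · exact hxy
    · exact hxz
    · exact hxy.symm
    · exact Adjacent.refl _
    · exact hyz
    · exact hxz.symm
    · exact hyz.symm
    · exact Adjacent.refl _⟩

/-- A vertex as a 0-simplex. -/
def point {V : Type} (r : V → V → Prop) (x : V) : Simplex r 0 := ⟨fun _ => x, fun _ _ => Or.inl rfl⟩

theorem boundary_single_one {V : Type} {r : V → V → Prop} (t : Simplex r 1) (c : ℤ) :
    boundary r 0 (Finsupp.single t c) =
      c • (Finsupp.single (point r (t.1 1)) 1 - Finsupp.single (point r (t.1 0)) 1) := by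
  have h0 : t.face 0 = point r (t.1 1) := Subtype.ext (funext fun a => by fin_cases a; rfl)
  have h1 : t.face 1 = point r (t.1 0) := Subtype.ext (funext fun a => by fin_cases a; rfl)
  simp [boundary, Finsupp.linearCombination_single, Fin.sum_univ_two, h0, h1, sub_eq_add_neg]

theorem boundary_single_two {V : Type} {r : V → V → Prop} (t : Simplex r 2) (c : ℤ) :
    boundary r 1 (Finsupp.single t c) =
      c • (Finsupp.single (segment (r := r) (t.2 1 2)) 1 -
        Finsupp.single (segment (r := r) (t.2 0 2)) 1 +
        Finsupp.single (segment (r := r) (t.2 0 1)) 1) := by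
  have h0 : t.face 0 = segment (r := r) (t.2 1 2) :=
    Subtype.ext (funext fun a => by fin_cases a <;> rfl)
  have h1 : t.face 1 = segment (r := r) (t.2 0 2) :=
    Subtype.ext (funext fun a => by fin_cases a <;> rfl)
  have h2 : t.face 2 = segment (r := r) (t.2 0 1) :=
    Subtype.ext (funext fun a => by fin_cases a <;> rfl)
  simp [boundary, Finsupp.linearCombination_single, Fin.sum_univ_three, h0, h1, h2, sub_eq_add_neg]

/-- 1-chains modulo boundaries. -/
abbrev ChainClass (r : Idx n → Idx n → Prop) : Type := Chains r 1 ⧸ LinearMap.range (boundary r 1)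

open Classical in
/-- The class of the segment joining two vertices, zero if there is none. -/
def segmentClass (x y : Idx n) : ChainClass (edge n) :=
  if h : Adjacent (edge n) x y then Submodule.Quotient.mk (Finsupp.single (segment h) 1) else 0

theorem segmentClass_of_adjacent {x y : Idx n} (h : Adjacent (edge n) x y) :
    segmentClass x y = Submodule.Quotient.mk (Finsupp.single (segment h) 1) := dif_pos h

theorem segmentClass_add {x y z : Idx n} (hxy : Adjacent (edge n) x y)
    (hyz : Adjacent (edge n) y z) (hxz : Adjacent (edge n) x z) :
    segmentClass x y + segmentClass y z = segmentClass x z := by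
  rw [segmentClass_of_adjacent hxy, segmentClass_of_adjacent hyz, segmentClass_of_adjacent hxz,
    ← Submodule.Quotient.mk_add, Submodule.Quotient.eq]
  refine ⟨Finsupp.single (triangle hxy hyz hxz) 1, ?_⟩
  rw [boundary_single_two, one_smul]
  change Finsupp.single (segment hyz) 1 - Finsupp.single (segment hxz) 1 +
    Finsupp.single (segment hxy) 1 = _
  abel

theorem segmentClass_self (x : Idx n) : segmentClass x x = 0 := by
  have h := segmentClass_add (Adjacent.refl x) (Adjacent.refl x) (Adjacent.refl (r := edge n) x)
  simpa using h

theorem segmentClass_symm {x y : Idx n} (h : Adjacent (edge n) x y) :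
    segmentClass y x = -segmentClass x y := by
  have h1 := segmentClass_add h h.symm (Adjacent.refl x)
  rw [segmentClass_self] at h1
  exact eq_neg_of_add_eq_zero_right h1

/-- The cochain which counts the passages from the fourth block to the first. -/
def turn (i j : Fin 4) : ℤ := if i = 3 ∧ j = 0 then 1 else if i = 0 ∧ j = 3 then -1 else 0

/-- The counting cochain as a functional on 1-chains. -/
def turnChain (n : Fin 4 → ℕ) : Chains (edge n) 1 →ₗ[ℤ] ℤ :=
  Finsupp.linearCombination ℤ fun t => turn (t.1 0).1 (t.1 1).1

theorem turnChain_single (t : Simplex (edge n) 1) (c : ℤ) :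
    turnChain n (Finsupp.single t c) = c * turn (t.1 0).1 (t.1 1).1 := by
  simp [turnChain, Finsupp.linearCombination_single]

theorem adjacent_fst {x y : Idx n} (h : Adjacent (edge n) x y) :
    Adjacent (fun i j : Fin 4 => i = j ∨ ((i = 0 ∨ i = 1) ∧ (j = 2 ∨ j = 3))) x.1 y.1 :=
  h.imp (congrArg Sigma.fst) id

theorem adjacent_of_fst {x y : Idx n}
    (h : Adjacent (fun i j : Fin 4 => i = j ∨ ((i = 0 ∨ i = 1) ∧ (j = 2 ∨ j = 3))) x.1 y.1) :
    Adjacent (edge n) x y := by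
  rcases h with h | h
  · exact Or.inr (Or.inl (Or.inl h))
  · exact Or.inr h

/-- Pairwise adjacent blocks include at most one source and one range, so the cocycle condition is a
finite check on triples of blocks. -/
theorem turnChain_boundary (c : Chains (edge n) 2) : turnChain n (boundary (edge n) 1 c) = 0 := by
  have h : turnChain n ∘ₗ boundary (edge n) 1 = 0 := by
    refine Finsupp.lhom_ext fun t c => ?_
    have key : ∀ i j k : Fin 4,
        (i = j ∨ (i = j ∨ ((i = 0 ∨ i = 1) ∧ (j = 2 ∨ j = 3))) ∨
          (j = i ∨ ((j = 0 ∨ j = 1) ∧ (i = 2 ∨ i = 3)))) →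
        (j = k ∨ (j = k ∨ ((j = 0 ∨ j = 1) ∧ (k = 2 ∨ k = 3))) ∨
          (k = j ∨ ((k = 0 ∨ k = 1) ∧ (j = 2 ∨ j = 3)))) →
        (i = k ∨ (i = k ∨ ((i = 0 ∨ i = 1) ∧ (k = 2 ∨ k = 3))) ∨
          (k = i ∨ ((k = 0 ∨ k = 1) ∧ (i = 2 ∨ i = 3)))) →
        turn j k - turn i k + turn i j = 0 := by decide
    rw [LinearMap.comp_apply, boundary_single_two, map_smul, map_add, map_sub, turnChain_single,
      turnChain_single, turnChain_single]
    have := key _ _ _ (adjacent_fst (t.2 0 1)) (adjacent_fst (t.2 1 2)) (adjacent_fst (t.2 0 2))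
    simp only [segment, one_mul, LinearMap.zero_apply]
    exact (congrArg _ this).trans (smul_zero c)
  exact LinearMap.congr_fun h c

/-- The number of turns of a homology class around the 4-cycle. -/
def turnNumber (n : Fin 4 → ℕ) : H1 (edge n) →ₗ[ℤ] ℤ :=
  Submodule.liftQ _ ((turnChain n).domRestrict _) (by
    rintro ⟨c, hc⟩ ⟨d, hd⟩
    rw [LinearMap.mem_ker, LinearMap.domRestrict_apply]
    change turnChain n c = 0
    rw [← show boundary (edge n) 1 d = c from hd, turnChain_boundary])

/-! ### The standard loop as a generator of homology. -/

/-- The base vertex of a block. -/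
def base (hn : ∀ i, 0 < n i) (i : Fin 4) : Idx n := ⟨i, 0, hn i⟩

/-- The class of the standard path from the base vertex of the first block. -/
def pathClass (hn : ∀ i, 0 < n i) : Fin 4 → ChainClass (edge n) :=
  ![0, segmentClass (base hn 0) (base hn 2) + segmentClass (base hn 2) (base hn 1),
    segmentClass (base hn 0) (base hn 2),
    segmentClass (base hn 0) (base hn 2) + segmentClass (base hn 2) (base hn 1) +
      segmentClass (base hn 1) (base hn 3)]

/-- The class of the standard loop around the 4-cycle. -/
def loopClass (hn : ∀ i, 0 < n i) : ChainClass (edge n) :=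
  pathClass hn 3 + segmentClass (base hn 3) (base hn 0)

/-- The standard paths run along the spanning tree `0 - 2 - 1 - 3` of the 4-cycle; only the
remaining edge, between `3` and `0`, contributes the loop. -/
theorem segmentClass_base (hn : ∀ i, 0 < n i) (i j : Fin 4)
    (h : Adjacent (edge n) (base hn i) (base hn j)) :
    segmentClass (base hn i) (base hn j) =
      turn i j • loopClass hn + pathClass hn j - pathClass hn i := by
  have hs := segmentClass_symm h
  have h' := adjacent_fst h
  fin_cases i <;> fin_cases j <;>
    simp [turn, loopClass, pathClass, segmentClass_self, Adjacent, base] at hs h' ⊢ <;>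
    simp only [hs] <;> abel

/-- `φ` sends a vertex to the class of a path reaching it from the base vertex of the first block.
Modulo boundaries, a segment is then the difference of two such paths plus a multiple of the loop.
On cycles the `φ` term vanishes, which yields `turnNumber_injective`. -/
theorem mk_eq_turn_add (hn : ∀ i, 0 < n i) : ∃ φ : Chains (edge n) 0 →ₗ[ℤ] ChainClass (edge n),
    ∀ c : Chains (edge n) 1, (Submodule.Quotient.mk c : ChainClass (edge n)) =
      turnChain n c • loopClass hn + φ (boundary (edge n) 0 c) := by
  let φ : Chains (edge n) 0 →ₗ[ℤ] ChainClass (edge n) := Finsupp.linearCombination ℤ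
    fun t => pathClass hn (t.1 0).1 + segmentClass (base hn (t.1 0).1) (t.1 0)
  have hφ : ∀ x, φ (Finsupp.single (point (edge n) x) 1) =
      pathClass hn x.1 + segmentClass (base hn x.1) x := fun x => by
    exact (Finsupp.linearCombination_single ℤ 1 (point (edge n) x)).trans (one_smul ℤ _)
  refine ⟨φ, fun c => ?_⟩
  have h : (LinearMap.range (boundary (edge n) 1)).mkQ =
      (turnChain n).smulRight (loopClass hn) + φ ∘ₗ boundary (edge n) 0 := by
    refine Finsupp.lhom_ext fun t z => ?_
    obtain ⟨x, hx⟩ : ∃ x, t.1 0 = x := ⟨_, rfl⟩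
    obtain ⟨y, hy⟩ : ∃ y, t.1 1 = y := ⟨_, rfl⟩
    have hxy : Adjacent (edge n) x y := hx ▸ hy ▸ t.2 0 1
    have ht : t = segment hxy := Subtype.ext (funext fun a => by
      fin_cases a
      · exact hx
      · exact hy)
    have hb : ∀ x : Idx n, Adjacent (edge n) (base hn x.1) x :=
      fun x => Or.inr (Or.inl (Or.inl rfl))
    have hbb : Adjacent (edge n) (base hn x.1) (base hn y.1) :=
      adjacent_of_fst (by simpa only [base] using adjacent_fst hxy)
    have hxb : Adjacent (edge n) (base hn x.1) y :=
      adjacent_of_fst (by simpa only [base] using adjacent_fst hxy)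
    have key : (Submodule.Quotient.mk (Finsupp.single t 1) : ChainClass (edge n)) =
        turn x.1 y.1 • loopClass hn + ((pathClass hn y.1 + segmentClass (base hn y.1) y) -
          (pathClass hn x.1 + segmentClass (base hn x.1) x)) := by
      have h1 := segmentClass_add (hb x) hxy hxb
      have h2 := segmentClass_add hbb (hb y) hxb
      rw [segmentClass_base hn _ _ hbb, ← h1] at h2
      rw [ht, ← segmentClass_of_adjacent hxy, ← sub_eq_iff_eq_add'.2 h2]
      abel
    have hz : Finsupp.single t z = z • Finsupp.single t (1 : ℤ) := by simp
    rw [hz, map_smul, map_smul]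
    congr 1
    rw [Submodule.mkQ_apply, key, LinearMap.add_apply, LinearMap.comp_apply, boundary_single_one,
      one_smul, map_sub, hφ, hφ, hx, hy, LinearMap.smulRight_apply, turnChain_single,
      one_mul, hx, hy]
  exact LinearMap.congr_fun h c

theorem turnNumber_mk (c : LinearMap.ker (boundary (edge n) 0)) :
    turnNumber n (Submodule.Quotient.mk c) = turnChain n c := rfl

theorem turnNumber_injective (hn : ∀ i, 0 < n i) : Function.Injective (turnNumber n) := by
  rw [injective_iff_map_eq_zero]
  intro x hx
  obtain ⟨⟨c, hc⟩, rfl⟩ := Submodule.Quotient.mk_surjective _ x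
  obtain ⟨φ, hφ⟩ := mk_eq_turn_add hn
  have h := hφ c
  rw [turnNumber_mk] at hx
  rw [LinearMap.mem_ker] at hc
  rw [hx, hc, zero_smul, map_zero, add_zero, Submodule.Quotient.mk_eq_zero] at h
  rw [Submodule.Quotient.mk_eq_zero]
  exact h

theorem adjacent_base (hn : ∀ i, 0 < n i) {i j : Fin 4} (hi : i = 0 ∨ i = 1) (hj : j = 2 ∨ j = 3) :
    Adjacent (edge n) (base hn i) (base hn j) := Or.inr (Or.inl (Or.inr ⟨hi, hj⟩))

/-- The standard loop around the 4-cycle. -/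
def loopChain (hn : ∀ i, 0 < n i) : Chains (edge n) 1 :=
  Finsupp.single (segment (adjacent_base hn (i := 0) (j := 2) (by simp) (by simp))) 1 +
  Finsupp.single (segment (adjacent_base hn (i := 1) (j := 2) (by simp) (by simp)).symm) 1 +
  Finsupp.single (segment (adjacent_base hn (i := 1) (j := 3) (by simp) (by simp))) 1 +
  Finsupp.single (segment (adjacent_base hn (i := 0) (j := 3) (by simp) (by simp)).symm) 1

theorem boundary_loopChain (hn : ∀ i, 0 < n i) : boundary (edge n) 0 (loopChain hn) = 0 := by
  simp only [loopChain, map_add, boundary_single_one, one_smul]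
  simp only [segment, Matrix.cons_val_zero, Matrix.cons_val_one]
  abel

/-- The homology class of the standard loop. -/
def loop (hn : ∀ i, 0 < n i) : H1 (edge n) :=
  Submodule.Quotient.mk ⟨loopChain hn, boundary_loopChain hn⟩

theorem turnNumber_loop (hn : ∀ i, 0 < n i) : turnNumber n (loop hn) = 1 := by
  rw [loop, turnNumber_mk]
  simp only [loopChain, map_add, turnChain_single]
  simp [segment, base, turn]

/-- The first homology group of a 4-cycle algebra is infinite cyclic. -/
def turnEquiv (hn : ∀ i, 0 < n i) : H1 (edge n) ≃+ ℤ :=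
  AddEquiv.ofBijective (turnNumber n).toAddMonoidHom
    ⟨turnNumber_injective hn, fun z => ⟨z • loop hn, by
      change turnNumber n (z • loop hn) = z
      rw [map_smul, turnNumber_loop, smul_eq_mul, mul_one]⟩⟩

theorem turnEquiv_apply (hn : ∀ i, 0 < n i) (x : H1 (edge n)) : turnEquiv hn x = turnNumber n x :=
  rfl

theorem eq_turnNumber_smul_loop (hn : ∀ i, 0 < n i) (x : H1 (edge n)) :
    x = turnNumber n x • loop hn :=
  turnNumber_injective hn (by rw [map_smul, turnNumber_loop, smul_eq_mul, mul_one])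

/-- The loop generates, so one evaluation per symmetry suffices, and the turns of the image loop
depend only on `σ`. -/
theorem turnNumber_H1map (hn : ∀ i, 0 < n i) {f : Idx n → Idx m} {σ : Equiv.Perm (Fin 4)}
    (hσ : IsSymmetry σ) (hfσ : ∀ v, (f v).1 = σ v.1) (hf : ∀ v w, edge n v w → edge m (f v) (f w))
    (x : H1 (edge n)) : turnNumber m (H1map f hf x) = symmSign σ * turnNumber n x := by
  conv_lhs => rw [eq_turnNumber_smul_loop hn x]
  rw [map_zsmul, map_zsmul, smul_eq_mul, mul_comm]
  congr 1
  have h : turnNumber m (H1map f hf (loop hn)) = turnChain m (chainMap f hf 1 (loopChain hn)) := rfl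
  rw [h]
  simp only [loopChain, map_add, chainMap, Finsupp.lmapDomain_apply, Finsupp.mapDomain_single,
    turnChain_single, one_mul]
  simp only [Simplex.map, segment, Matrix.cons_val_zero, Matrix.cons_val_one, hfσ, base]
  have key : ∀ σ : Equiv.Perm (Fin 4), (∀ i j, (i = j ∨ ((i = 0 ∨ i = 1) ∧ (j = 2 ∨ j = 3))) ↔
      (σ i = σ j ∨ ((σ i = 0 ∨ σ i = 1) ∧ (σ j = 2 ∨ σ j = 3)))) →
      turn (σ 0) (σ 2) + turn (σ 2) (σ 1) + turn (σ 1) (σ 3) + turn (σ 3) (σ 0) = symmSign σ := by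
    unfold symmSign
    decide
  exact key σ hσ

theorem RigidDecomposition.turnNumber_H1map (hn : ∀ i, 0 < n i) {α : StarEmbedding n m}
    (D : RigidDecomposition α) (x : H1 (edge n)) :
    turnNumber m (D.H1map x) = (∑ s, symmSign (D.type s)) * turnNumber n x := by
  rw [RigidDecomposition.H1map, AddMonoidHom.finsetSum_apply, map_sum, Finset.sum_mul]
  exact Finset.sum_congr rfl fun s _ =>
    FourCycle.turnNumber_H1map hn (D.type_isSymmetry s) (D.emb_block s) (D.emb_edge s) x

end Homology

end FourCycle
end

noncomputable section

namespace FourCycle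

namespace System

/-! ### Lifts of isomorphisms of limit algebras -/

section Lift

variable {A B C : System}

theorem trans_injective (A : System) (i j : ℕ) (h : i ≤ j) :
    Function.Injective (A.trans i j h) := by
  induction h with
  | refl => rw [trans_self]; exact fun _ _ h => h
  | step h ih => rw [trans_succ _ _ _ h]; exact (A.map _).injective.comp ih

/-- The canonical map of a full matrix algebra into the direct limit. -/
def toLimit (A : System) (i : ℕ) : Mat (A.dim i) →⋆ₙₐ[ℂ] A.StarLimit where
  toFun x := ⟦⟨i, x⟩⟧
  map_smul' c x := (DirectLimit.smul_def (f := A.trans) i x c).symm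
  map_zero' := (DirectLimit.zero_def (f := A.trans) i).symm
  map_add' x y := (DirectLimit.add_def (f := A.trans) i x y).symm
  map_mul' x y := (DirectLimit.mul_def (f := A.trans) i x y).symm
  map_star' x := (DirectLimit.star_def (f := A.trans) i x).symm

theorem toLimit_apply (A : System) (i : ℕ) (x : Mat (A.dim i)) : A.toLimit i x = ⟦⟨i, x⟩⟧ := rfl

theorem toLimit_injective (A : System) (i : ℕ) : Function.Injective (A.toLimit i) :=
  DirectLimit.mk_injective A.trans A.trans_injective i

theorem toLimit_trans (A : System) {i j : ℕ} (h : i ≤ j) (x : Mat (A.dim i)) :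
    A.toLimit j (A.trans i j h x) = A.toLimit i x := by
  rw [toLimit_apply, toLimit_apply]
  exact DirectLimit.mk_apply (f := A.trans) i j x h

theorem toLimit_mem_limit (A : System) {i : ℕ} {x : Mat (A.dim i)}
    (hx : x ∈ cycleAlgebra (A.dim i)) :
    A.toLimit i x ∈ A.limit := ⟨i, x, hx, rfl⟩

/-- `φ` is the restriction of `θ` to the `i`-th algebra, with values in the `j`-th algebra. -/
def IsLift (θ : A.StarLimit ≃⋆ₐ[ℂ] B.StarLimit) {i j : ℕ}
    (φ : Mat (A.dim i) →⋆ₙₐ[ℂ] Mat (B.dim j)) : Prop :=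
  ∀ x, θ (A.toLimit i x) = B.toLimit j (φ x)

theorem IsLift.unique {θ : A.StarLimit ≃⋆ₐ[ℂ] B.StarLimit} {i j : ℕ}
    {φ ψ : Mat (A.dim i) →⋆ₙₐ[ℂ] Mat (B.dim j)} (hφ : IsLift θ φ) (hψ : IsLift θ ψ) : φ = ψ := by
  ext1 x
  exact B.toLimit_injective j (by rw [← hφ, ← hψ])

theorem IsLift.trans_comp {θ : A.StarLimit ≃⋆ₐ[ℂ] B.StarLimit} {i j k : ℕ}
    {φ : Mat (A.dim i) →⋆ₙₐ[ℂ] Mat (B.dim j)} (hφ : IsLift θ φ) (h : j ≤ k) :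
    IsLift θ ((B.trans j k h).comp φ) := fun x => by
  rw [NonUnitalStarAlgHom.comp_apply, toLimit_trans, hφ]

theorem IsLift.comp_trans {θ : A.StarLimit ≃⋆ₐ[ℂ] B.StarLimit} {i j k : ℕ}
    {φ : Mat (A.dim j) →⋆ₙₐ[ℂ] Mat (B.dim k)} (hφ : IsLift θ φ) (h : i ≤ j) :
    IsLift θ (φ.comp (A.trans i j h)) := fun x => by
  rw [NonUnitalStarAlgHom.comp_apply, ← hφ, toLimit_trans]

/-- This exhibits a lift as a factor of a connecting map. -/
theorem IsLift.comp_symm {θ : A.StarLimit ≃⋆ₐ[ℂ] B.StarLimit} {i j k : ℕ}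
    {φ : Mat (A.dim i) →⋆ₙₐ[ℂ] Mat (B.dim j)} {ψ : Mat (B.dim j) →⋆ₙₐ[ℂ] Mat (A.dim k)}
    (hφ : IsLift θ φ) (hψ : IsLift θ.symm ψ) (h : i ≤ k) : ψ.comp φ = A.trans i k h := by
  ext1 x
  refine A.toLimit_injective k ?_
  rw [NonUnitalStarAlgHom.comp_apply, ← hψ, ← hφ, StarAlgEquiv.symm_apply_apply, toLimit_trans]

theorem IsLift.injective {θ : A.StarLimit ≃⋆ₐ[ℂ] B.StarLimit} {i j : ℕ}
    {φ : Mat (A.dim i) →⋆ₙₐ[ℂ] Mat (B.dim j)} (hφ : IsLift θ φ) : Function.Injective φ := by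
  intro x y hxy
  refine A.toLimit_injective i (EquivLike.injective θ ?_)
  rw [hφ, hφ, hxy]

/-- The finitely many matrix units all have their images at one common stage; linearity does the
rest. -/
theorem exists_forall_eq_toLimit {θ : A.StarLimit ≃⋆ₐ[ℂ] B.StarLimit}
    (hθ : ∀ x, θ x ∈ B.limit ↔ x ∈ A.limit) (i N : ℕ) :
    ∃ j, N ≤ j ∧ ∀ x : Mat (A.dim i), ∃ y, θ (A.toLimit i x) = B.toLimit j y ∧
      (x ∈ cycleAlgebra (A.dim i) → y ∈ cycleAlgebra (B.dim j)) := by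
  have h1 : ∀ q : Idx (A.dim i) × Idx (A.dim i), ∃ (k : ℕ) (y : Mat (B.dim k)),
      θ (A.toLimit i (Matrix.single q.1 q.2 1)) = B.toLimit k y ∧
      (edge (A.dim i) q.1 q.2 → y ∈ cycleAlgebra (B.dim k)) := by
    intro q
    by_cases hq : edge (A.dim i) q.1 q.2
    · obtain ⟨k, y, hy, h⟩ := (hθ _).2 (A.toLimit_mem_limit (single_mem_cycleAlgebra 1 hq))
      exact ⟨k, y, h, fun _ => hy⟩
    · obtain ⟨k, y, h⟩ := DirectLimit.exists_eq_mk _ (θ (A.toLimit i (Matrix.single q.1 q.2 1)))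
      exact ⟨k, y, h, fun h => absurd h hq⟩
  choose k y hy hmem using h1
  let j := max N (Finset.univ.sup k)
  have hk : ∀ q, k q ≤ j := fun q => le_max_of_le_right (Finset.le_sup (Finset.mem_univ q))
  refine ⟨j, le_max_left _ _, fun x =>
    ⟨∑ v, ∑ w, x v w • B.trans _ j (hk (v, w)) (y (v, w)), ?_, ?_⟩⟩
  · have h2 : x = ∑ v, ∑ w, x v w • Matrix.single v w (1 : ℂ) := by
      conv_lhs => rw [Matrix.matrix_eq_sum_single x]
      simp_rw [Matrix.smul_single, smul_eq_mul, mul_one]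
    conv_lhs => rw [h2]
    simp only [map_sum, map_smul]
    refine Finset.sum_congr rfl fun v _ => Finset.sum_congr rfl fun w _ => ?_
    rw [hy (v, w), toLimit_trans]
  · intro hx
    refine sum_mem fun v _ => sum_mem fun w _ => ?_
    by_cases hvw : edge (A.dim i) v w
    · exact Subalgebra.smul_mem _ (B.trans_mem _ _ _ _ (hmem (v, w) hvw)) _
    · rw [hx v w hvw, zero_smul]
      exact zero_mem _

/-- The chosen preimages form a star homomorphism because `B.toLimit j` is an injective one. -/
theorem exists_isLift {θ : A.StarLimit ≃⋆ₐ[ℂ] B.StarLimit}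
    (hθ : ∀ x, θ x ∈ B.limit ↔ x ∈ A.limit) (i N : ℕ) :
    ∃ j, N ≤ j ∧ ∃ φ : Mat (A.dim i) →⋆ₙₐ[ℂ] Mat (B.dim j), IsLift θ φ ∧
      ∀ a ∈ cycleAlgebra (A.dim i), φ a ∈ cycleAlgebra (B.dim j) := by
  obtain ⟨j, hj, h⟩ := exists_forall_eq_toLimit hθ i N
  choose f hf hmem using h
  have hinj := B.toLimit_injective j
  exact ⟨j, hj,
    { toFun := f
      map_smul' := fun c x => hinj (by
        rw [← hf, map_smul, map_smul, hf, ← map_smul]; rfl)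
      map_zero' := hinj (by rw [← hf, map_zero, map_zero, map_zero])
      map_add' := fun x y => hinj (by rw [← hf, map_add, map_add, hf, hf, map_add])
      map_mul' := fun x y => hinj (by rw [← hf, map_mul, map_mul, hf, hf, map_mul])
      map_star' := fun x => hinj (by rw [← hf, map_star, map_star, hf, map_star]) }, hf, hmem⟩

theorem symm_mem_limit_iff {θ : A.StarLimit ≃⋆ₐ[ℂ] B.StarLimit}
    (hθ : ∀ x, θ x ∈ B.limit ↔ x ∈ A.limit) (x : B.StarLimit) :
    θ.symm x ∈ A.limit ↔ x ∈ B.limit := by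
  rw [← hθ, StarAlgEquiv.apply_symm_apply]

end Lift

/-! ### The limit homology groups -/

section LimitHomology

variable {A B : System}

theorem Decomposition.isRegular_trans (D : A.Decomposition) (i j : ℕ) (h : i ≤ j) :
    IsRegular (A.trans i j h) := by
  induction h with
  | refl => rw [System.trans_self]; exact IsRegular.id
  | step h ih => rw [System.trans_succ _ _ _ h]; exact (D _).isRegular.comp ih

/-- One integer is both the winding number, which depends on the star homomorphism only, and the
multiplier on homology. -/
theorem Decomposition.exists_hasWinding_trans (D : A.Decomposition) (i j : ℕ) (h : i ≤ j) :
    ∃ z : ℤ, HasWinding (A.trans i j h) z ∧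
      ∀ x, turnNumber (A.dim j) (D.trans i j h x) = z * turnNumber (A.dim i) x := by
  induction h with
  | refl =>
    rw [System.trans_self, Decomposition.trans_self]
    exact ⟨1, by simpa using HasWinding.id, fun x => (one_mul _).symm⟩
  | @step k h ih =>
    obtain ⟨z, hz, hx⟩ := ih
    rw [System.trans_succ _ _ _ h, Decomposition.trans_succ _ _ _ h]
    refine ⟨(∑ s, symmSign ((D k).type s)) * z, ?_, fun x => ?_⟩
    · rw [Int.cast_mul]
      exact (D k).hasWinding.comp hz
    · rw [AddMonoidHom.comp_apply, (D k).turnNumber_H1map (A.dim_pos k), hx, mul_assoc]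

/-- Lifting `θ.symm` back into the first system makes `φ` a factor of a connecting map, which is
regular. -/
theorem exists_isLift_hasWinding (D : A.Decomposition) {θ : A.StarLimit ≃⋆ₐ[ℂ] B.StarLimit}
    (hθ : ∀ x, θ x ∈ B.limit ↔ x ∈ A.limit) (i N : ℕ) :
    ∃ j, N ≤ j ∧ ∃ (φ : Mat (A.dim i) →⋆ₙₐ[ℂ] Mat (B.dim j)) (z : ℤ),
      IsLift θ φ ∧ HasWinding φ z := by
  obtain ⟨j, hj, φ, hφ, hφm⟩ := exists_isLift hθ i N
  obtain ⟨k, hk, ψ, hψ, hψm⟩ := exists_isLift (symm_mem_limit_iff hθ) j i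
  obtain ⟨z, hz⟩ := exists_hasWinding_of_comp (A.dim_pos i) (B.dim_pos j) hφm hψm hφ.injective
    hψ.injective (by rw [hφ.comp_symm hψ hk]; exact D.isRegular_trans i k hk)
  exact ⟨j, hj, φ, z, hφ, hz⟩

/-! ### Transport of homology classes along lifts. -/

/-- The class in the limit homology group with a given turn number in the `j`-th homology group. -/
def turnClass (E : B.Decomposition) (j : ℕ) (z : ℤ) : B.limitH1 E :=
  ⟦⟨j, (turnEquiv (B.dim_pos j)).symm z⟩⟧

theorem turnClass_add (E : B.Decomposition) (j : ℕ) (z w : ℤ) :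
    turnClass E j (z + w) = turnClass E j z + turnClass E j w := by
  rw [turnClass, map_add]
  exact (DirectLimit.add_def (f := Decomposition.trans E) j _ _).symm

theorem turnClass_turnNumber (E : B.Decomposition) (j : ℕ) (x : H1 (edge (B.dim j))) :
    turnClass E j (turnNumber _ x) = ⟦⟨j, x⟩⟧ := by
  rw [turnClass, ← turnEquiv_apply (B.dim_pos j), AddEquiv.symm_apply_apply]

theorem turnClass_eq_of_hasWinding (E : B.Decomposition) {j k : ℕ} (h : j ≤ k) {t : ℤ}
    (ht : HasWinding (B.trans j k h) t) (z : ℤ) : turnClass E j z = turnClass E k (t * z) := by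
  obtain ⟨t', ht', hx⟩ := E.exists_hasWinding_trans j k h
  have : t = t' := by exact_mod_cast ht.unique (B.dim_pos j) ht'
  subst this
  have hz : z = turnNumber _ ((turnEquiv (B.dim_pos j)).symm z) := by
    rw [← turnEquiv_apply (B.dim_pos j), AddEquiv.apply_symm_apply]
  conv_rhs => rw [hz, ← hx, turnClass_turnNumber]
  exact (DirectLimit.mk_apply (f := Decomposition.trans E) j k _ h).symm

/-- Pushed to a common stage the two lifts coincide, so their winding numbers agree after
multiplication by those of the connecting maps. -/
theorem turnClass_eq_of_isLift (E : B.Decomposition) {θ : A.StarLimit ≃⋆ₐ[ℂ] B.StarLimit}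
    {i j j' : ℕ} {φ : Mat (A.dim i) →⋆ₙₐ[ℂ] Mat (B.dim j)}
    {φ' : Mat (A.dim i) →⋆ₙₐ[ℂ] Mat (B.dim j')} (hφ : IsLift θ φ) (hφ' : IsLift θ φ') {z z' : ℤ}
    (hz : HasWinding φ z) (hz' : HasWinding φ' z') (t : ℤ) :
    turnClass E j (z * t) = turnClass E j' (z' * t) := by
  obtain ⟨s, hs, -⟩ := E.exists_hasWinding_trans j _ (le_max_left j j')
  obtain ⟨s', hs', -⟩ := E.exists_hasWinding_trans j' _ (le_max_right j j')
  have h1 := hs.comp hz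
  rw [(hφ.trans_comp (le_max_left j j')).unique (hφ'.trans_comp (le_max_right j j'))] at h1
  have h2 : s * z = s' * z' := by exact_mod_cast h1.unique (A.dim_pos i) (hs'.comp hz')
  rw [turnClass_eq_of_hasWinding E _ hs, turnClass_eq_of_hasWinding E _ hs', ← mul_assoc, h2,
    mul_assoc]

/-- The formula is asserted for every lift, not just for those chosen to define `F`, so that later
arguments can use whichever lift is convenient. -/
theorem exists_limitH1_map (D : A.Decomposition) (E : B.Decomposition)
    {θ : A.StarLimit ≃⋆ₐ[ℂ] B.StarLimit} (hθ : ∀ x, θ x ∈ B.limit ↔ x ∈ A.limit) :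
    ∃ F : A.limitH1 D → B.limitH1 E, ∀ {i j : ℕ} {φ : Mat (A.dim i) →⋆ₙₐ[ℂ] Mat (B.dim j)} {z : ℤ},
      IsLift θ φ → HasWinding φ z → ∀ x : H1 (edge (A.dim i)),
        F ⟦⟨i, x⟩⟧ = turnClass E j (z * turnNumber _ x) := by
  choose j _ φ z hφ hz using fun i => exists_isLift_hasWinding D hθ i 0
  refine ⟨DirectLimit.lift _ (fun i x => turnClass E (j i) (z i * turnNumber _ x)) ?_, ?_⟩
  · intro i i' h x
    obtain ⟨t, ht, hx⟩ := D.exists_hasWinding_trans i i' h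
    rw [hx, ← mul_assoc]
    refine turnClass_eq_of_isLift E (hφ i) ((hφ i').comp_trans h) (hz i) ?_ _
    rw [Int.cast_mul]
    exact (hz i').comp ht
  · intro i j' φ' z' hφ' hz' x
    exact turnClass_eq_of_isLift E (hφ i) hφ' (hz i) hz' _

theorem leftInverse_of_isLift (D : A.Decomposition) (E : B.Decomposition)
    {θ : A.StarLimit ≃⋆ₐ[ℂ] B.StarLimit} (hθ : ∀ x, θ x ∈ B.limit ↔ x ∈ A.limit)
    {F : A.limitH1 D → B.limitH1 E} {G : B.limitH1 E → A.limitH1 D}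
    (hF : ∀ {i j : ℕ} {φ : Mat (A.dim i) →⋆ₙₐ[ℂ] Mat (B.dim j)} {z : ℤ},
      IsLift θ φ → HasWinding φ z → ∀ x : H1 (edge (A.dim i)),
        F ⟦⟨i, x⟩⟧ = turnClass E j (z * turnNumber _ x))
    (hG : ∀ {i j : ℕ} {φ : Mat (B.dim i) →⋆ₙₐ[ℂ] Mat (A.dim j)} {z : ℤ},
      IsLift θ.symm φ → HasWinding φ z → ∀ x : H1 (edge (B.dim i)),
        G ⟦⟨i, x⟩⟧ = turnClass D j (z * turnNumber _ x)) : Function.LeftInverse G F := by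
  refine DirectLimit.induction _ fun i x => ?_
  obtain ⟨j, -, φ, z, hφ, hz⟩ := exists_isLift_hasWinding D hθ i 0
  -- The bound `i` on the stage makes `ψ.comp φ` the connecting map from stage `i` to stage `k`,
  -- whose winding number is `w * z`.
  obtain ⟨k, hk, ψ, w, hψ, hw⟩ := exists_isLift_hasWinding E (symm_mem_limit_iff hθ) j i
  rw [hF hφ hz, turnClass, hG hψ hw, ← turnEquiv_apply (B.dim_pos j), AddEquiv.apply_symm_apply,
    ← turnClass_turnNumber, ← mul_assoc]
  refine (turnClass_eq_of_hasWinding D hk ?_ _).symm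
  rw [← hφ.comp_symm hψ hk, Int.cast_mul]
  exact hw.comp hz

end LimitHomology

end System

end FourCycle
end
-- The isomorphism of the limit groups.
theorem theorem3p3 (A B : FourCycle.System) (hA : A.IsGeneric) (hB : B.IsGeneric)
    (h : A.StarExtendiblyIsomorphic B) (D : A.Decomposition) (E : B.Decomposition) :
    Nonempty (A.limitH1 D ≃+ B.limitH1 E) := by
  obtain ⟨θ, hθ⟩ := h
  have hθ' := FourCycle.System.symm_mem_limit_iff hθ
  obtain ⟨F, hF⟩ := FourCycle.System.exists_limitH1_map D E hθ
  obtain ⟨G, hG⟩ := FourCycle.System.exists_limitH1_map E D hθ'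
  refine ⟨{ toFun := F, invFun := G, left_inv := ?_, right_inv := ?_, map_add' := ?_ }⟩
  · exact FourCycle.System.leftInverse_of_isLift D E hθ hF hG
  · exact FourCycle.System.leftInverse_of_isLift E D hθ' hG hF
  -- Both classes are represented at one stage, where a single lift computes all three values of
  -- `F`.
  · refine DirectLimit.induction₂ _ fun i x y => ?_
    obtain ⟨j, -, φ, z, hφ, hz⟩ := FourCycle.System.exists_isLift_hasWinding D hθ i 0
    rw [DirectLimit.add_def, hF hφ hz, hF hφ hz, hF hφ hz, ← FourCycle.System.turnClass_add,
      map_add, mul_add]
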